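/- **Theorem (The Four Grid Rules).** Let $a,v\in\mathbb C$ and $F(z)=z^3-3a^2z+(2a^3+v)$, a monic centered cubic polynomial with critical points $\pm a$. Write $a_k=F^{\circ k}(a)$ for $k\ge 0$. Assume that the orbit $a=a_0\mapsto a_1\mapsto a_2\mapsto\cdots$ is bounded and that the orbit of $-a$ is unbounded. Let $G_F(z)=\lim_{n\to\infty}3^{-n}\log^+|F^{\circ n}(z)|$ be the Green's function and $K_F=\{G_F=0\}$ the filled Julia set. Let $P_0=\{z\in\mathbb C: G_F(z)<G_F(F(-a))\}$ and, for $z\in K_F$, let $P_0(z)=P_0$ and, for $\ell>0$, let $P_\ell(z)$ be the connected component of $F^{-\ell}(P_0)$ containing $z$. For $x,y\in K_F$ let $L(x,y)\in\mathbb N\cup\{\infty\}$ be the largest $\ell$ with $P_\ell(x)=P_\ell(y)$ (and $\infty$ if this holds for all $\ell$), and let $d_F(x,y)=2^{-L(x,y)}$, with $2^{-\infty}=0$. Define the critical marked grid, for integers $\ell,k\ge 0$, by $M(\ell,k)=1$ if $\ell\le L(a_0,a_k)$, and $M(\ell,k)=0$ otherwise. Then, for all integers $\ell,k,m\ge 0$: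 - **(R1)** $1=M(0,k)\ge M(1,k)\ge M(2,k)\ge\cdots\ge 0$. - **(R2)** If $M(\ell,k)=1$, then $M(\ell-i,k+i)=M(\ell-i,i)$ for $0\le i\le\ell$. - **(R3)** Suppose that $k\le\ell$, that $d_F(a_0,a_m)=2^{-\ell}$, that $d_F(a_0,a_i)>2^{i-\ell}$ for $0<i<k$, and that $d_F(a_0,a_k)<2^{k-\ell}$. Then $d_F(a_0,a_{m+k})=2^{k-\ell}$. - **(R4)** Suppose that $d_F(a_0,a_k)=2^{-\ell}$, that $d_F(a_0,a_{k+i})>2^{i-\ell}$ for $0<i<\ell$, and that $d_F(a_0,a_\ell)=1$. Then $d_F(a_0,a_{\ell+k})<1$. -/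

import Mathlib

namespace CubicPuzzle

open Filter

/-- The monic centered cubic map `F(z) = z³ - 3a²z + (2a³ + v)`, with marked critical point `a`,
free critical point `-a`, and marked critical value `F(a) = v`. -/
def F (a v z : ℂ) : ℂ := z ^ 3 - 3 * a ^ 2 * z + (2 * a ^ 3 + v)

/-- The marked critical orbit `a = a₀ ↦ a₁ ↦ a₂ ↦ ⋯`. -/
def critOrbit (a v : ℂ) (k : ℕ) : ℂ := (F a v)^[k] a

/-- The Green's function `G_F(z) = lim 3⁻ⁿ log⁺ |Fⁿ(z)|` (the limit exists for every `z`). -/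
noncomputable def green (a v z : ℂ) : ℝ :=
  limUnder atTop fun n : ℕ => Real.posLog ‖(F a v)^[n] z‖ / 3 ^ n

/-- The puzzle piece of level zero: all `z` with `G_F(z) < G_F(F(-a))`. -/
def pieceZero (a v : ℂ) : Set ℂ := {z | green a v z < green a v (F a v (-a))}

/-- `P_ℓ(z)`, the puzzle piece of level `ℓ` around a point `z` of the filled Julia set:
the whole of `P₀` if `ℓ = 0`, the connected component of `F^{-ℓ}(P₀)` containing `z` if `ℓ > 0`. -/
def piece (a v : ℂ) : ℕ → ℂ → Set ℂ
  | 0, _ => pieceZero a v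
  | ℓ + 1, z => connectedComponentIn ((F a v)^[ℓ + 1] ⁻¹' pieceZero a v) z

/-- The greatest common level `L(x,y) ∈ ℕ ∪ {∞}` of two points of the filled Julia set: the
supremum of the levels `ℓ` with `P_ℓ(x) = P_ℓ(y)`. As the pieces around a point are nested, this
is the largest such level, and is `∞` exactly if `P_ℓ(x) = P_ℓ(y)` for all `ℓ`. -/
noncomputable def commonLevel (a v x y : ℂ) : ℕ∞ :=
  ⨆ (ℓ : ℕ) (_ : piece a v ℓ x = piece a v ℓ y), (ℓ : ℕ∞)

open Classical in
/-- The puzzle pseudometric `d_F(x,y) = 2^{-L(x,y)}`, with `2^{-∞} = 0`. -/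
noncomputable def puzzleDist (a v x y : ℂ) : ℝ :=
  if commonLevel a v x y = ⊤ then 0 else (2 : ℝ) ^ (-((commonLevel a v x y).toNat : ℤ))

open Classical in
/-- The critical marked grid: `M(ℓ,k) = 1` if `ℓ ≤ L(a₀,a_k)`, and `M(ℓ,k) = 0` otherwise. -/
noncomputable def grid (a v : ℂ) (ℓ k : ℕ) : ℕ :=
  if (ℓ : ℕ∞) ≤ commonLevel a v (critOrbit a v 0) (critOrbit a v k) then 1 else 0

/-- `d_F(a₀, a_k)`. -/
noncomputable def critDist (a v : ℂ) (k : ℕ) : ℝ :=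
  puzzleDist a v (critOrbit a v 0) (critOrbit a v k)

end CubicPuzzle

namespace CubicPuzzle

open Filter Topology Asymptotics

variable {a v : ℂ}

/-! ### Elementary facts on the cubic map -/

/-! Since `G(F z) = 3 G(z)`, a puzzle piece of level `ℓ` is a component of `{G < 3 G(-a) / 3^ℓ}`
(`piece_eq_comp`), so the rules express how `F` acts on components of sublevel sets. Components are
nested, and `F` maps them onto components (`image_comp`); this gives (R1) and (R2).

For (R3) and (R4), equality of pieces is pulled back along `F`: if `x, y` share a piece of some
level `n ≥ 1` and `F x, F y` also share one of level `n`, then `x, y` share one of level `n + 1`. If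
the piece around `x` omits `a`, this holds because `F` is injective on it (`injOn_comp`). If `x =
a`, it holds because the fibre over `F a` is `{a, -2a}` and the cocritical point `-2a` is already
separated from `a` at level one (`mem_comp_marked_of_F_mem`). Iteration gives `SamePiece.pullback`,
from which (R3) and (R4) follow by contradiction; (R4) also uses that there are only two pieces of
level one.

The topological input is that `{G < c}` is connected for `c > G(-a)` (`isPreconnected_sublevel`),
that it is disconnected at `c = G(-a)` (`cocritical_notMem_comp`), and the injectivity just
mentioned. Winding numbers mod 2 take the place of the Jordan curve theorem and Riemann–Hurwitz: if
`z - p` has no continuous square root on a compact set (`HasSqrtOn`), that set separates `p` from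
infinity, and the maximum principle for `G` limits where this can occur. -/

lemma F_sub_marked (z : ℂ) : F a v z - F a v a = (z - a) ^ 2 * (z + 2 * a) := by
  unfold F; ring

lemma F_sub_free (z : ℂ) : F a v z - F a v (-a) = (z + a) ^ 2 * (z - 2 * a) := by
  unfold F; ring

lemma F_sub_F (x y : ℂ) : F a v x - F a v y = (x - y) * (x ^ 2 + x * y + y ^ 2 - 3 * a ^ 2) := by
  unfold F; ring

lemma differentiable_F : Differentiable ℂ (F a v) := by
  unfold F; fun_prop

lemma continuous_F : Continuous (F a v) := differentiable_F.continuous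

lemma differentiable_iterate (n : ℕ) : Differentiable ℂ (F a v)^[n] :=
  differentiable_F.iterate n

lemma hasDerivAt_F (z : ℂ) : HasDerivAt (F a v) (3 * (z - a) * (z + a)) z := by
  have h : HasDerivAt (F a v) (3 * z ^ 2 - 3 * a ^ 2 * 1) z := by
    have h1 : HasDerivAt (fun z : ℂ => z ^ 3) (3 * z ^ 2) z := by
      simpa using hasDerivAt_pow 3 z
    exact (h1.sub ((hasDerivAt_id z).const_mul (3 * a ^ 2))).add_const _
  convert h using 1; ring

lemma eq_or_eq_of_F_eq_marked {z : ℂ} (h : F a v z = F a v a) : z = a ∨ z = -2 * a := by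
  have h1 := F_sub_marked (a := a) (v := v) z
  rw [h, sub_self] at h1
  rcases mul_eq_zero.1 h1.symm with h2 | h2
  · exact Or.inl (sub_eq_zero.1 (pow_eq_zero_iff two_ne_zero |>.1 h2))
  · right; linear_combination h2

lemma F_neg_two_mul : F a v (-2 * a) = F a v a := by unfold F; ring

lemma F_two_mul : F a v (2 * a) = F a v (-a) := by unfold F; ring

lemma isOpenMap_F : IsOpenMap (F a v) := by
  intro s hs
  have han : AnalyticOnNhd ℂ (F a v) Set.univ :=
    differentiable_F.differentiableOn.analyticOnNhd isOpen_univ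
  rcases han.is_constant_or_isOpen isPreconnected_univ with ⟨w, hw⟩ | h
  · exfalso
    have h0 := hw 0 trivial
    have h1 := hw 1 trivial
    have h2 := hw (-1) trivial
    have h3 := hw 2 trivial
    unfold F at h0 h1 h2 h3
    have : (6 : ℂ) = 0 := by linear_combination h3 - 2 * h1 + h0
    norm_num at this
  · exact h s (Set.subset_univ _) hs

lemma isOpenMap_iterate (n : ℕ) : IsOpenMap (F a v)^[n] := by
  induction n with
  | zero => exact IsOpenMap.id
  | succ n ih => exact ih.comp isOpenMap_F

/-- The relative deviation of `F` from `z ↦ z³`. -/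
noncomputable def dev (a v z : ℂ) : ℂ := (-3 * a ^ 2 * z + (2 * a ^ 3 + v)) / z ^ 3

/-- A radius outside of which the cubic map behaves like `z ↦ z³`. -/
noncomputable def escRadius (a v : ℂ) : ℝ := 8 * (1 + 3 * ‖a‖ ^ 2 + ‖2 * a ^ 3 + v‖)

lemma eight_le_escRadius : 8 ≤ escRadius a v := by
  unfold escRadius; nlinarith [norm_nonneg (2 * a ^ 3 + v), sq_nonneg ‖a‖]

lemma F_eq_mul_dev {z : ℂ} (hz : z ≠ 0) : F a v z = z ^ 3 * (1 + dev a v z) := by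
  unfold F dev; field_simp; ring

lemma norm_dev_le {z : ℂ} (hz : escRadius a v ≤ ‖z‖) : ‖dev a v z‖ ≤ 1 / 8 := by
  have h8 : 8 ≤ ‖z‖ := eight_le_escRadius.trans hz
  have hpos : 0 < ‖z‖ ^ 3 := by positivity
  unfold dev
  rw [norm_div, norm_pow, div_le_iff₀ hpos]
  have h1 : ‖-3 * a ^ 2 * z + (2 * a ^ 3 + v)‖ ≤ 3 * ‖a‖ ^ 2 * ‖z‖ + ‖2 * a ^ 3 + v‖ := by
    refine (norm_add_le _ _).trans ?_
    simp
  have h2 : 8 * (3 * ‖a‖ ^ 2 + ‖2 * a ^ 3 + v‖) ≤ ‖z‖ := by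
    unfold escRadius at hz; linarith
  have h3 : 8 * (3 * ‖a‖ ^ 2 * ‖z‖ + ‖2 * a ^ 3 + v‖) ≤ ‖z‖ * ‖z‖ := by
    nlinarith [norm_nonneg (2 * a ^ 3 + v), sq_nonneg ‖a‖]
  nlinarith [mul_pos (by linarith : 0 < ‖z‖) (by linarith : 0 < ‖z‖)]

lemma ne_zero_of_escRadius_le {z : ℂ} (hz : escRadius a v ≤ ‖z‖) : z ≠ 0 := by
  have := eight_le_escRadius (a := a) (v := v)
  intro h; rw [h, norm_zero] at hz; linarith

lemma norm_one_add_dev_ge {z : ℂ} (hz : escRadius a v ≤ ‖z‖) : 7 / 8 ≤ ‖1 + dev a v z‖ := by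
  have h := norm_sub_norm_le (1 : ℂ) (-dev a v z)
  rw [norm_neg, norm_one, sub_neg_eq_add] at h
  linarith [norm_dev_le hz]

lemma norm_F_ge {z : ℂ} (hz : escRadius a v ≤ ‖z‖) : 7 / 8 * ‖z‖ ^ 3 ≤ ‖F a v z‖ := by
  rw [F_eq_mul_dev (ne_zero_of_escRadius_le hz), norm_mul, norm_pow]
  nlinarith [norm_one_add_dev_ge hz, pow_nonneg (norm_nonneg z) 3]

lemma escRadius_le_norm_F {z : ℂ} (hz : escRadius a v ≤ ‖z‖) : escRadius a v ≤ ‖F a v z‖ := by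
  have h8 : 8 ≤ ‖z‖ := eight_le_escRadius.trans hz
  have h64 : 64 ≤ ‖z‖ ^ 2 := by nlinarith
  have := norm_F_ge hz
  have h3 : ‖z‖ ^ 3 = ‖z‖ * ‖z‖ ^ 2 := by ring
  nlinarith

lemma escRadius_le_norm_iterate {z : ℂ} (hz : escRadius a v ≤ ‖z‖) (n : ℕ) :
    escRadius a v ≤ ‖(F a v)^[n] z‖ := by
  induction n with
  | zero => simpa
  | succ n ih => rw [Function.iterate_succ_apply']; exact escRadius_le_norm_F ih

/-! ### The Green's function -/

/-- Compactness handles the disc of radius `escRadius`; outside it the difference is `log |1 +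
dev|`. The uniformity in `z` is what makes `G` continuous. -/
lemma exists_posLog_F_bound (a v : ℂ) :
    ∃ C : ℝ, ∀ z, |Real.posLog ‖F a v z‖ - 3 * Real.posLog ‖z‖| ≤ C := by
  have hR := eight_le_escRadius (a := a) (v := v)
  have hcont : ContinuousOn (fun z => |Real.posLog ‖F a v z‖ - 3 * Real.posLog ‖z‖|)
      (Metric.closedBall 0 (escRadius a v)) := by
    have h1 : Continuous fun z => Real.posLog ‖F a v z‖ :=
      Real.continuous_posLog.comp continuous_F.norm
    have h2 : Continuous fun z : ℂ => Real.posLog ‖z‖ :=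
      Real.continuous_posLog.comp continuous_norm
    exact ((h1.sub (h2.const_mul 3)).abs).continuousOn
  obtain ⟨C, hC⟩ := (isCompact_closedBall (0 : ℂ) (escRadius a v)).bddAbove_image hcont
  -- `|log (1 + w)| ≤ 3/2 |w|` for `|w| ≤ 1/2`, applied with `|dev| ≤ 1/8`.
  refine ⟨max C (3 / 2 * (1 / 8)), fun z => ?_⟩
  rcases le_total ‖z‖ (escRadius a v) with hz | hz
  · exact le_max_of_le_left (hC ⟨z, by simpa using hz, rfl⟩)
  · apply le_max_of_le_right
    have hz0 := ne_zero_of_escRadius_le hz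
    have hdev := norm_dev_le hz
    have h1 : 1 ≤ |‖z‖| := by rw [abs_norm]; linarith
    have h2 : 1 ≤ |‖F a v z‖| := by
      rw [abs_norm]; linarith [escRadius_le_norm_F hz]
    have hne : ‖1 + dev a v z‖ ≠ 0 := by linarith [norm_one_add_dev_ge hz]
    rw [Real.posLog_eq_log h1, Real.posLog_eq_log h2, F_eq_mul_dev hz0, norm_mul, norm_pow,
      Real.log_mul (by simpa using hz0) hne, Real.log_pow]
    have h3 : Real.log ‖1 + dev a v z‖ = (Complex.log (1 + dev a v z)).re :=
      (Complex.log_re _).symm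
    have h4 := (Complex.abs_re_le_norm _).trans
      (Complex.norm_log_one_add_half_le_self (z := dev a v z) (by linarith))
    rw [← h3] at h4
    push_cast
    rw [add_sub_cancel_left]
    linarith

lemma exists_green_estimate (a v : ℂ) : ∃ C : ℝ, ∀ z,
    Tendsto (fun n : ℕ => Real.posLog ‖(F a v)^[n] z‖ / 3 ^ n) atTop (𝓝 (green a v z)) ∧
      |Real.posLog ‖z‖ - green a v z| ≤ C := by
  obtain ⟨C, hC⟩ := exists_posLog_F_bound a v
  refine ⟨C / 3 / (1 - 1 / 3), fun z => ?_⟩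
  have hstep : ∀ n : ℕ, dist (Real.posLog ‖(F a v)^[n] z‖ / 3 ^ n)
      (Real.posLog ‖(F a v)^[n + 1] z‖ / 3 ^ (n + 1)) ≤ C / 3 * (1 / 3) ^ n := by
    intro n
    have h := hC ((F a v)^[n] z)
    rw [← Function.iterate_succ_apply' (F a v)] at h
    rw [dist_comm, Real.dist_eq]
    have : Real.posLog ‖(F a v)^[n + 1] z‖ / 3 ^ (n + 1) - Real.posLog ‖(F a v)^[n] z‖ / 3 ^ n
        = (Real.posLog ‖(F a v)^[n + 1] z‖ - 3 * Real.posLog ‖(F a v)^[n] z‖) / 3 ^ (n + 1) := by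
      rw [pow_succ]; field_simp
    rw [this, abs_div, abs_of_pos (by positivity : (0 : ℝ) < 3 ^ (n + 1)),
      div_le_iff₀ (by positivity)]
    refine h.trans (le_of_eq ?_)
    rw [one_div, inv_pow, pow_succ]
    field_simp
  have hlim : Tendsto (fun n : ℕ => Real.posLog ‖(F a v)^[n] z‖ / 3 ^ n) atTop
      (𝓝 (green a v z)) :=
    tendsto_nhds_limUnder (cauchySeq_tendsto_of_complete
      (cauchySeq_of_le_geometric (1 / 3) (C / 3) (by norm_num) hstep))
  refine ⟨hlim, ?_⟩
  have := dist_le_of_le_geometric_of_tendsto₀ (1 / 3) (C / 3) (by norm_num) hstep hlim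
  simpa [Real.dist_eq] using this

lemma tendsto_green (z : ℂ) :
    Tendsto (fun n : ℕ => Real.posLog ‖(F a v)^[n] z‖ / 3 ^ n) atTop (𝓝 (green a v z)) := by
  obtain ⟨_, hC⟩ := exists_green_estimate a v
  exact (hC z).1

lemma green_F (z : ℂ) : green a v (F a v z) = 3 * green a v z := by
  have h1 := ((tendsto_green (a := a) (v := v) z).comp (tendsto_add_atTop_nat 1)).const_mul 3
  refine tendsto_nhds_unique (tendsto_green (F a v z)) (h1.congr fun n => ?_)
  simp only [Function.comp_apply, Function.iterate_succ_apply]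
  rw [pow_succ]; field_simp

lemma green_iterate (n : ℕ) (z : ℂ) : green a v ((F a v)^[n] z) = 3 ^ n * green a v z := by
  induction n with
  | zero => simp
  | succ n ih => rw [Function.iterate_succ_apply', green_F, ih, pow_succ]; ring

lemma green_nonneg (z : ℂ) : 0 ≤ green a v z :=
  ge_of_tendsto' (tendsto_green z) fun _ => div_nonneg Real.posLog_nonneg (by positivity)

lemma continuous_green : Continuous (green a v) := by
  obtain ⟨C, hC⟩ := exists_green_estimate a v
  have hunif : TendstoUniformly (fun (n : ℕ) z => Real.posLog ‖(F a v)^[n] z‖ / 3 ^ n)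
      (green a v) atTop := by
    rw [Metric.tendstoUniformly_iff]
    intro ε hε
    have h0 : Tendsto (fun n : ℕ => C * (1 / 3 : ℝ) ^ n) atTop (𝓝 0) := by
      simpa using (tendsto_pow_atTop_nhds_zero_of_lt_one (r := (1 / 3 : ℝ)) (by norm_num)
        (by norm_num)).const_mul C
    filter_upwards [h0.eventually (gt_mem_nhds hε)] with n hn z
    refine lt_of_le_of_lt ?_ hn
    -- The estimate at `Fⁿ z`, divided by `3ⁿ`, is the rate of uniform convergence.
    have h := (hC ((F a v)^[n] z)).2
    rw [green_iterate] at h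
    rw [dist_comm, Real.dist_eq]
    have : Real.posLog ‖(F a v)^[n] z‖ / 3 ^ n - green a v z
        = (Real.posLog ‖(F a v)^[n] z‖ - 3 ^ n * green a v z) / 3 ^ n := by
      field_simp
    rw [this, abs_div, abs_of_pos (by positivity : (0 : ℝ) < 3 ^ n), div_le_iff₀ (by positivity)]
    refine h.trans (le_of_eq ?_)
    rw [one_div, inv_pow]; field_simp
  refine hunif.continuous (Frequently.of_forall fun n => ?_)
  exact (Real.continuous_posLog.comp (differentiable_iterate n).continuous.norm).div_const _

lemma isBounded_green_le (c : ℝ) : Bornology.IsBounded {z | green a v z ≤ c} := by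
  obtain ⟨C, hC⟩ := exists_green_estimate a v
  refine (Metric.isBounded_closedBall (x := (0 : ℂ)) (r := Real.exp (c + C))).subset ?_
  intro z hz
  have h := (abs_le.1 (hC z).2).2
  have h1 : Real.posLog ‖z‖ ≤ c + C := by have : green a v z ≤ c := hz; linarith
  rw [Real.posLog_eq_log_max_one (norm_nonneg z), Real.log_le_iff_le_exp (by positivity)] at h1
  simpa using (le_max_right _ _).trans h1

lemma isCompact_green_le (c : ℝ) : IsCompact {z | green a v z ≤ c} :=
  Metric.isCompact_of_isClosed_isBounded (isClosed_le continuous_green continuous_const)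
    (isBounded_green_le c)

lemma green_eq_zero_iff (z : ℂ) :
    green a v z = 0 ↔ Bornology.IsBounded (Set.range fun n : ℕ => (F a v)^[n] z) := by
  constructor
  · intro h
    refine (isBounded_green_le (a := a) (v := v) 0).subset ?_
    rintro _ ⟨n, rfl⟩
    simp [green_iterate, h]
  · intro h
    obtain ⟨M, hM⟩ := h.exists_norm_le
    refine tendsto_nhds_unique (tendsto_green z) ?_
    refine squeeze_zero (fun n => div_nonneg Real.posLog_nonneg (by positivity))
      (g := fun n : ℕ => Real.posLog M * (1 / 3) ^ n) (fun n => ?_) ?_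
    · rw [div_eq_mul_inv, one_div, inv_pow]
      refine mul_le_mul_of_nonneg_right ?_ (by positivity)
      exact Real.posLog_le_posLog (norm_nonneg _) (hM _ ⟨n, rfl⟩)
    · simpa using (tendsto_pow_atTop_nhds_zero_of_lt_one (r := (1 / 3 : ℝ)) (by norm_num)
        (by norm_num)).const_mul (Real.posLog M)

lemma exists_lt_norm_iterate {p : ℂ} (hp : 0 < green a v p) (R : ℝ) :
    ∃ n : ℕ, R < ‖(F a v)^[n] p‖ := by
  by_contra! h
  have hb : Bornology.IsBounded (Set.range fun n : ℕ => (F a v)^[n] p) := by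
    refine (Metric.isBounded_closedBall (x := (0 : ℂ)) (r := R)).subset ?_
    rintro _ ⟨n, rfl⟩
    simpa using h n
  exact hp.ne' ((green_eq_zero_iff p).2 hb)

/-! ### The Böttcher coordinate near infinity -/

/-- The logarithm of `φ(z) / z`, where `φ` is the Böttcher coordinate near infinity. -/
noncomputable def bottcherLog (a v z : ℂ) : ℂ :=
  ∑' n : ℕ, (1 / 3 : ℂ) ^ (n + 1) * Complex.log (1 + dev a v ((F a v)^[n] z))

lemma norm_bottcherLog_term_le {z : ℂ} (hz : escRadius a v ≤ ‖z‖) (n : ℕ) :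
    ‖(1 / 3 : ℂ) ^ (n + 1) * Complex.log (1 + dev a v ((F a v)^[n] z))‖
      ≤ 1 / 16 * (1 / 3 : ℝ) ^ n := by
  have h1 := norm_dev_le (escRadius_le_norm_iterate hz n)
  have h2 := Complex.norm_log_one_add_half_le_self (z := dev a v ((F a v)^[n] z)) (by linarith)
  have h3 : ‖(1 / 3 : ℂ)‖ = 1 / 3 := by norm_num
  rw [norm_mul, norm_pow, h3, pow_succ]
  have h4 : (0 : ℝ) < (1 / 3) ^ n := by positivity
  nlinarith

lemma hasSum_bottcherLog_bound : HasSum (fun n : ℕ => 1 / 16 * (1 / 3 : ℝ) ^ n) (3 / 32) := by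
  have := (hasSum_geometric_of_lt_one (r := (1 / 3 : ℝ)) (by norm_num) (by norm_num)).mul_left
    (1 / 16)
  rwa [show (1 / 16 * (1 - 1 / 3)⁻¹ : ℝ) = 3 / 32 by norm_num] at this

lemma norm_bottcherLog_le {z : ℂ} (hz : escRadius a v ≤ ‖z‖) : ‖bottcherLog a v z‖ ≤ 3 / 32 :=
  tsum_of_norm_bounded hasSum_bottcherLog_bound (norm_bottcherLog_term_le hz)

lemma hasSum_bottcherLog {z : ℂ} (hz : escRadius a v ≤ ‖z‖) :
    HasSum (fun n : ℕ => (1 / 3 : ℂ) ^ (n + 1) * Complex.log (1 + dev a v ((F a v)^[n] z)))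
      (bottcherLog a v z) :=
  (Summable.of_norm_bounded hasSum_bottcherLog_bound.summable
    (norm_bottcherLog_term_le hz)).hasSum

lemma isOpen_escRadius_lt : IsOpen {z : ℂ | escRadius a v < ‖z‖} :=
  isOpen_lt continuous_const continuous_norm

lemma one_add_mem_slitPlane {w : ℂ} (hw : ‖w‖ < 1) : 1 + w ∈ Complex.slitPlane := by
  left
  have := (abs_le.1 (Complex.abs_re_le_norm w)).1
  simp only [Complex.add_re, Complex.one_re]
  linarith

lemma differentiableOn_bottcherLog :
    DifferentiableOn ℂ (bottcherLog a v) {z : ℂ | escRadius a v < ‖z‖} := by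
  refine Complex.differentiableOn_tsum_of_summable_norm hasSum_bottcherLog_bound.summable
    (fun n => ?_) isOpen_escRadius_lt fun n z hz => norm_bottcherLog_term_le (le_of_lt hz) n
  intro z hz
  have hz' := escRadius_le_norm_iterate (le_of_lt hz) n
  have hdev : DifferentiableAt ℂ (dev a v) ((F a v)^[n] z) := by
    unfold dev
    have := pow_ne_zero 3 (ne_zero_of_escRadius_le hz')
    fun_prop (disch := assumption)
  have h1 : DifferentiableAt ℂ (fun z => 1 + dev a v ((F a v)^[n] z)) z :=
    (hdev.comp z (differentiable_iterate n z)).const_add 1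
  exact ((h1.clog (one_add_mem_slitPlane
    (by linarith [norm_dev_le hz']))).const_mul _).differentiableWithinAt

lemma log_norm_iterate {z : ℂ} (hz : escRadius a v ≤ ‖z‖) (n : ℕ) :
    Real.log ‖(F a v)^[n] z‖ / 3 ^ n = Real.log ‖z‖ +
      ∑ k ∈ Finset.range n,
        ((1 / 3 : ℂ) ^ (k + 1) * Complex.log (1 + dev a v ((F a v)^[k] z))).re := by
  induction n with
  | zero => simp
  | succ n ih =>
    rw [Finset.sum_range_succ, ← add_assoc, ← ih, Function.iterate_succ_apply']
    have hn := escRadius_le_norm_iterate hz n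
    have hz0 := ne_zero_of_escRadius_le hn
    have hne : ‖1 + dev a v ((F a v)^[n] z)‖ ≠ 0 := by linarith [norm_one_add_dev_ge hn]
    have h13 : (1 / 3 : ℂ) ^ (n + 1) = (((1 / 3 : ℝ) ^ (n + 1) : ℝ) : ℂ) := by push_cast; rfl
    rw [F_eq_mul_dev hz0, norm_mul, norm_pow, Real.log_mul (by simpa using hz0) hne,
      Real.log_pow, h13, Complex.re_ofReal_mul, Complex.log_re, one_div, inv_pow, pow_succ]
    push_cast
    field_simp

lemma green_eq_log_add {z : ℂ} (hz : escRadius a v ≤ ‖z‖) :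
    green a v z = Real.log ‖z‖ + (bottcherLog a v z).re := by
  have h1 := (Complex.hasSum_re (hasSum_bottcherLog hz)).tendsto_sum_nat.const_add (Real.log ‖z‖)
  refine tendsto_nhds_unique (tendsto_green z) (h1.congr fun n => ?_)
  have hn := escRadius_le_norm_iterate hz n
  have h8 := eight_le_escRadius (a := a) (v := v)
  rw [← log_norm_iterate hz n, Real.posLog_eq_log (by rw [abs_norm]; linarith)]

/-- The Böttcher coordinate near infinity. -/
noncomputable def bottcher (a v z : ℂ) : ℂ := z * Complex.exp (bottcherLog a v z)

lemma norm_bottcher {z : ℂ} (hz : escRadius a v ≤ ‖z‖) :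
    ‖bottcher a v z‖ = Real.exp (green a v z) := by
  rw [green_eq_log_add hz, Real.exp_add, Real.exp_log (norm_pos_iff.2 (ne_zero_of_escRadius_le hz)),
    bottcher, norm_mul, Complex.norm_exp]

lemma differentiableOn_bottcher :
    DifferentiableOn ℂ (bottcher a v) {z : ℂ | escRadius a v < ‖z‖} :=
  differentiableOn_id.mul differentiableOn_bottcherLog.cexp

/-- With `h = bottcherLog`, the derivative is `exp h * (1 + z h')`. Cauchy's estimate on the disc of
radius `|z|/2` gives `|z h'| ≤ 3/16`; the factor 2 keeps that disc in the domain of `h`. -/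
lemma deriv_bottcher_ne_zero {z : ℂ} (hz : 2 * escRadius a v < ‖z‖) :
    deriv (bottcher a v) z ≠ 0 := by
  have h8 := eight_le_escRadius (a := a) (v := v)
  have hzpos : 0 < ‖z‖ / 2 := by linarith
  have hsub : ∀ w ∈ Metric.closedBall z (‖z‖ / 2), escRadius a v < ‖w‖ := by
    intro w hw
    rw [Metric.mem_closedBall, dist_comm, dist_eq_norm] at hw
    linarith [norm_sub_norm_le z w]
  have hcl : DiffContOnCl ℂ (bottcherLog a v) (Metric.ball z (‖z‖ / 2)) := by
    refine DifferentiableOn.diffContOnCl_ball (U := {z : ℂ | escRadius a v < ‖z‖}) ?_ hsub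
    exact differentiableOn_bottcherLog
  have hderiv := Complex.norm_deriv_le_of_forall_mem_sphere_norm_le hzpos hcl
    fun w hw => norm_bottcherLog_le (hsub w (Metric.sphere_subset_closedBall hw)).le
  have hd : HasDerivAt (bottcherLog a v) (deriv (bottcherLog a v) z) z :=
    (differentiableOn_bottcherLog.differentiableAt (isOpen_escRadius_lt.mem_nhds
      (hsub z (Metric.mem_closedBall_self hzpos.le)))).hasDerivAt
  have h := (hasDerivAt_id z).mul hd.cexp
  have h' : HasDerivAt (bottcher a v)
      (Complex.exp (bottcherLog a v z) * (1 + z * deriv (bottcherLog a v) z)) z := by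
    refine HasDerivAt.congr_deriv (f := bottcher a v) h ?_
    simp only [id]; ring
  rw [h'.deriv]
  refine mul_ne_zero (Complex.exp_ne_zero _) fun h0 => ?_
  have h1 : ‖z * deriv (bottcherLog a v) z‖ = 1 := by
    rw [eq_neg_of_add_eq_zero_right h0, norm_neg, norm_one]
  rw [norm_mul] at h1
  rw [le_div_iff₀ hzpos] at hderiv
  nlinarith

/-! ### Local behaviour of the Green's function off the filled Julia set -/

/-- Near a point where the Green's function is positive, it is, up to a factor, the logarithm of
the modulus of `φ ∘ Fⁿ`. -/
lemma exists_local_bottcher {p : ℂ} (hp : 0 < green a v p) : ∃ n : ℕ,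
    2 * escRadius a v < ‖(F a v)^[n] p‖ ∧
    ∀ᶠ z in 𝓝 p, ‖bottcher a v ((F a v)^[n] z)‖ = Real.exp (3 ^ n * green a v z) := by
  obtain ⟨n, hn⟩ := exists_lt_norm_iterate hp (2 * escRadius a v)
  have h8 := eight_le_escRadius (a := a) (v := v)
  refine ⟨n, hn, ?_⟩
  have hcont := (differentiable_iterate (a := a) (v := v) n).continuous.norm
  filter_upwards [hcont.continuousAt.eventually (lt_mem_nhds hn)] with z hz
  have hz' : escRadius a v < ‖(F a v)^[n] z‖ := by
    have : 2 * escRadius a v < ‖(F a v)^[n] z‖ := hz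
    linarith
  rw [norm_bottcher hz'.le, green_iterate]

lemma hasStrictDerivAt_bottcher {z : ℂ} (hz : 2 * escRadius a v < ‖z‖) :
    HasStrictDerivAt (bottcher a v) (deriv (bottcher a v) z) z := by
  have h8 := eight_le_escRadius (a := a) (v := v)
  have hz' : escRadius a v < ‖z‖ := by linarith
  exact (differentiableOn_bottcher.analyticAt
    (isOpen_escRadius_lt.mem_nhds hz')).hasStrictDerivAt

/-- Only openness is claimed, since `Fⁿ` may have a critical point at `p`. -/
lemma map_nhds_local_bottcher {p : ℂ} {n : ℕ} (hn : 2 * escRadius a v < ‖(F a v)^[n] p‖) :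
    𝓝 (bottcher a v ((F a v)^[n] p)) ≤ map (fun z => bottcher a v ((F a v)^[n] z)) (𝓝 p) := by
  have h1 := (hasStrictDerivAt_bottcher hn).map_nhds_eq (deriv_bottcher_ne_zero hn)
  rw [← h1]
  have h2 := map_mono (m := bottcher a v) ((isOpenMap_iterate (a := a) (v := v) n).nhds_le p)
  rwa [map_map] at h2

lemma exists_norm_lt_and_gt {w : ℂ} (hw : w ≠ 0) {O : Set ℂ} (hO : O ∈ 𝓝 w) :
    (∃ x ∈ O, ‖x‖ < ‖w‖) ∧ ∃ x ∈ O, ‖w‖ < ‖x‖ := by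
  have hcont : Tendsto (fun t : ℝ => (t : ℂ) * w) (𝓝 1) (𝓝 w) := by
    have : Continuous fun t : ℝ => (t : ℂ) * w := by fun_prop
    simpa using this.tendsto 1
  have hO' := hcont.eventually hO
  have hwpos := norm_pos_iff.2 hw
  obtain ⟨δ, hδ, hball⟩ := Metric.eventually_nhds_iff.1 hO'
  have hnorm : ∀ t : ℝ, 0 ≤ t → ‖(t : ℂ) * w‖ = t * ‖w‖ := fun t ht => by
    rw [norm_mul, Complex.norm_real, Real.norm_of_nonneg ht]
  have hm : 0 < min (δ / 2) (1 / 2) := by positivity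
  have hm1 := min_le_left (δ / 2) (1 / 2)
  have hm2 := min_le_right (δ / 2) (1 / 2 : ℝ)
  set s := min (δ / 2) (1 / 2)
  constructor
  · refine ⟨((1 - s : ℝ) : ℂ) * w, hball ?_, ?_⟩
    · rw [Real.dist_eq, abs_lt]; constructor <;> linarith
    · rw [hnorm _ (by linarith)]; nlinarith
  · refine ⟨((1 + s : ℝ) : ℂ) * w, hball ?_, ?_⟩
    · rw [Real.dist_eq, abs_lt]; constructor <;> linarith
    · rw [hnorm _ (by linarith)]; nlinarith

/-- Where it is positive, the Green's function has neither local minima nor local maxima. -/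
lemma exists_green_lt_and_gt {p : ℂ} (hp : 0 < green a v p) {O : Set ℂ} (hO : O ∈ 𝓝 p) :
    (∃ z ∈ O, green a v z < green a v p) ∧ ∃ z ∈ O, green a v p < green a v z := by
  obtain ⟨n, hn, hloc⟩ := exists_local_bottcher hp
  have hne : bottcher a v ((F a v)^[n] p) ≠ 0 := by
    rw [← norm_pos_iff, hloc.self_of_nhds]; positivity
  have himage := map_nhds_local_bottcher hn (image_mem_map (inter_mem hO hloc))
  have h3 : (0 : ℝ) < 3 ^ n := by positivity
  obtain ⟨⟨_, ⟨z, hz, rfl⟩, hlt⟩, ⟨_, ⟨z', hz', rfl⟩, hgt⟩⟩ := exists_norm_lt_and_gt hne himage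
  constructor
  · refine ⟨z, hz.1, ?_⟩
    rw [hz.2, hloc.self_of_nhds, Real.exp_lt_exp] at hlt
    exact lt_of_mul_lt_mul_left hlt h3.le
  · refine ⟨z', hz'.1, ?_⟩
    rw [hz'.2, hloc.self_of_nhds, Real.exp_lt_exp] at hgt
    exact lt_of_mul_lt_mul_left hgt h3.le

lemma exists_hasDerivAt_iterate {p : ℂ} (n : ℕ)
    (h : ∀ k < n, (F a v)^[k] p ≠ a ∧ (F a v)^[k] p ≠ -a) :
    ∃ d : ℂ, d ≠ 0 ∧ HasDerivAt (F a v)^[n] d p := by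
  induction n with
  | zero => exact ⟨1, one_ne_zero, hasDerivAt_id p⟩
  | succ n ih =>
    obtain ⟨d, hd, hder⟩ := ih fun k hk => h k (hk.trans n.lt_succ_self)
    obtain ⟨h1, h2⟩ := h n n.lt_succ_self
    refine ⟨3 * ((F a v)^[n] p - a) * ((F a v)^[n] p + a) * d, ?_, ?_⟩
    · refine mul_ne_zero (mul_ne_zero (mul_ne_zero three_ne_zero (sub_ne_zero.2 h1)) ?_) hd
      rwa [← sub_neg_eq_add, sub_ne_zero]
    · rw [Function.iterate_succ']
      exact (hasDerivAt_F ((F a v)^[n] p)).comp p hder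

/-- Near a point whose orbit escapes and avoids both critical points, the Green's function is, up
to a factor, the logarithm of the modulus of a local conformal coordinate. -/
lemma exists_conformal_coordinate {p : ℂ} (hp : 0 < green a v p)
    (hcrit : ∀ k, (F a v)^[k] p ≠ a ∧ (F a v)^[k] p ≠ -a) :
    ∃ (n : ℕ) (f : ℂ → ℂ) (d : ℂ), d ≠ 0 ∧ HasStrictDerivAt f d p ∧
      ∀ᶠ z in 𝓝 p, ‖f z‖ = Real.exp (3 ^ n * green a v z) := by
  obtain ⟨n, hn, hloc⟩ := exists_local_bottcher hp
  obtain ⟨d, hd, hder⟩ := exists_hasDerivAt_iterate n fun k _ => hcrit k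
  have hstrict : HasStrictDerivAt (F a v)^[n] d p := by
    have h := ((differentiable_iterate (a := a) (v := v) n).analyticAt p).hasStrictDerivAt
    rwa [hder.deriv] at h
  exact ⟨n, fun z => bottcher a v ((F a v)^[n] z), _, mul_ne_zero (deriv_bottcher_ne_zero hn) hd,
    (hasStrictDerivAt_bottcher hn).comp p hstrict, hloc⟩

/-- At a point above the level of the free critical point, sublevel sets of the Green's function
are locally connected. -/
lemma exists_nhds_isConnected_inter {p : ℂ} (ha : green a v a = 0)
    (hp : green a v (-a) < green a v p) {O : Set ℂ} (hO : O ∈ 𝓝 p) :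
    ∃ N ∈ 𝓝 p, N ⊆ O ∧ IsConnected (N ∩ {z | green a v z < green a v p}) := by
  have hp0 : 0 < green a v p := (green_nonneg _).trans_lt hp
  -- `G` does not decrease along the orbit of `p`, and both critical points have smaller `G` than
  -- `p`.
  have hcrit : ∀ k, (F a v)^[k] p ≠ a ∧ (F a v)^[k] p ≠ -a := by
    intro k
    have hk : green a v p ≤ green a v ((F a v)^[k] p) := by
      rw [green_iterate]
      exact le_mul_of_one_le_left hp0.le (one_le_pow₀ (by norm_num))
    constructor
    · intro h; rw [h, ha] at hk; linarith
    · intro h; rw [h] at hk; linarith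
  obtain ⟨n, f, d, hd, hf, hnorm⟩ := exists_conformal_coordinate hp0 hcrit
  have h3 : (0 : ℝ) < 3 ^ n := by positivity
  have hf' : HasStrictFDerivAt f
      (ContinuousLinearEquiv.unitsEquivAut ℂ (Units.mk0 d hd) : ℂ →L[ℂ] ℂ) p := by
    have := hf.hasStrictFDerivAt_equiv hd
    exact this
  set e := hf'.toOpenPartialHomeomorph f with he
  have hpe : p ∈ e.source := hf'.mem_toOpenPartialHomeomorph_source
  have hef : ∀ z, e z = f z := fun z => rfl
  have hO' : O ∩ {z | ‖f z‖ = Real.exp (3 ^ n * green a v z)} ∈ 𝓝 p := inter_mem hO hnorm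
  have hmem : e.target ∩ e.symm ⁻¹' (O ∩ {z | ‖f z‖ = Real.exp (3 ^ n * green a v z)}) ∈
      𝓝 (f p) := by
    refine inter_mem (e.open_target.mem_nhds (e.map_source hpe)) ?_
    refine (e.continuousAt_symm (e.map_source hpe)).preimage_mem_nhds ?_
    rwa [e.left_inv hpe]
  obtain ⟨r, hr, hball⟩ := Metric.mem_nhds_iff.1 hmem
  have hpn : ‖f p‖ = Real.exp (3 ^ n * green a v p) := hnorm.self_of_nhds
  have hfp : f p ≠ 0 := by rw [← norm_pos_iff, hpn]; positivity
  refine ⟨e.symm '' Metric.ball (f p) r, ?_, ?_, ?_⟩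
  · have h1 : e.source ∩ e ⁻¹' Metric.ball (f p) r ∈ 𝓝 p :=
      inter_mem (e.open_source.mem_nhds hpe)
        ((e.continuousAt hpe).preimage_mem_nhds (Metric.ball_mem_nhds _ hr))
    refine mem_of_superset h1 ?_
    rintro z ⟨hz, hz'⟩
    exact ⟨e z, hz', e.left_inv hz⟩
  · rintro _ ⟨w, hw, rfl⟩
    exact (hball hw).2.1
  -- In the coordinate `f`, the set `{G < G(p)}` is locally the disc of radius `|f p|` about 0,
  -- which meets a small disc about `f p` in a convex set.
  · have heq : e.symm '' Metric.ball (f p) r ∩ {z | green a v z < green a v p} =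
        e.symm '' (Metric.ball (f p) r ∩ Metric.ball 0 ‖f p‖) := by
      have key : ∀ w ∈ Metric.ball (f p) r,
          (green a v (e.symm w) < green a v p ↔ w ∈ Metric.ball (0 : ℂ) ‖f p‖) := by
        intro w hw
        have h1 : ‖f (e.symm w)‖ = Real.exp (3 ^ n * green a v (e.symm w)) := (hball hw).2.2
        have h2 : f (e.symm w) = w := e.right_inv (hball hw).1
        rw [h2] at h1
        rw [mem_ball_zero_iff, h1, hpn, Real.exp_lt_exp, mul_lt_mul_iff_right₀ h3]
      ext z
      constructor
      · rintro ⟨⟨w, hw, rfl⟩, hz⟩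
        exact ⟨w, ⟨hw, (key w hw).1 hz⟩, rfl⟩
      · rintro ⟨w, ⟨hw, hw'⟩, rfl⟩
        exact ⟨⟨w, hw, rfl⟩, (key w hw).2 hw'⟩
    rw [heq]
    refine ⟨?_, ?_⟩
    · obtain ⟨x, hx, hlt⟩ := (exists_norm_lt_and_gt hfp (Metric.ball_mem_nhds _ hr)).1
      exact Set.Nonempty.image _ ⟨x, hx, by simpa using hlt⟩
    · refine IsPreconnected.image ?_ _ ?_
      · exact ((convex_ball _ _).inter (convex_ball _ _)).isPreconnected
      · exact e.continuousOn_symm.mono fun w hw => (hball hw.1).1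

/-! ### Sublevel sets of the Green's function and their components -/

/-- The open sublevel set `{G < c}`. -/
def sublevel (a v : ℂ) (c : ℝ) : Set ℂ := {z | green a v z < c}

lemma mem_sublevel {c : ℝ} {z : ℂ} : z ∈ sublevel a v c ↔ green a v z < c := Iff.rfl

/-- The component of `{G < c}` around `z`. -/
def comp (a v : ℂ) (c : ℝ) (z : ℂ) : Set ℂ := connectedComponentIn (sublevel a v c) z

lemma isOpen_sublevel (c : ℝ) : IsOpen (sublevel a v c) :=
  isOpen_lt continuous_green continuous_const

lemma sublevel_mono {c c' : ℝ} (h : c ≤ c') : sublevel a v c ⊆ sublevel a v c' :=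
  fun _ hz => lt_of_lt_of_le hz h

lemma isOpen_comp {c : ℝ} {z : ℂ} : IsOpen (comp a v c z) :=
  (isOpen_sublevel c).connectedComponentIn

lemma comp_subset {c : ℝ} {z : ℂ} : comp a v c z ⊆ sublevel a v c :=
  connectedComponentIn_subset _ _

lemma mem_comp_self {c : ℝ} {z : ℂ} (hz : z ∈ sublevel a v c) : z ∈ comp a v c z :=
  mem_connectedComponentIn hz

lemma isPreconnected_comp {c : ℝ} {z : ℂ} : IsPreconnected (comp a v c z) :=
  isPreconnected_connectedComponentIn

lemma comp_eq {c : ℝ} {x y : ℂ} (h : y ∈ comp a v c x) : comp a v c x = comp a v c y :=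
  connectedComponentIn_eq h

lemma mem_comp_comm {c : ℝ} {x y : ℂ} (hx : x ∈ sublevel a v c) (h : y ∈ comp a v c x) :
    x ∈ comp a v c y := by
  rw [← comp_eq h]; exact mem_comp_self hx

lemma comp_eq_of_mem {c : ℝ} {x y z : ℂ} (hx : z ∈ comp a v c x) (hy : z ∈ comp a v c y) :
    comp a v c x = comp a v c y :=
  (comp_eq hx).trans (comp_eq hy).symm

lemma comp_mono {c c' : ℝ} (h : c ≤ c') (z : ℂ) : comp a v c z ⊆ comp a v c' z :=
  connectedComponentIn_mono z (sublevel_mono h)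

lemma subset_comp {c : ℝ} {z : ℂ} {s : Set ℂ} (hs : IsPreconnected s) (hz : z ∈ s)
    (hsub : s ⊆ sublevel a v c) : s ⊆ comp a v c z :=
  hs.subset_connectedComponentIn hz hsub

/-- Components of an open set of the plane are open, hence relatively closed in that set. -/
lemma mem_comp_of_mem_closure {c : ℝ} {x z : ℂ} (hx : x ∈ closure (comp a v c z))
    (hc : x ∈ sublevel a v c) : x ∈ comp a v c z := by
  obtain ⟨y, hy, hy'⟩ := mem_closure_iff.1 hx _ isOpen_comp (mem_comp_self hc)
  rw [comp_eq_of_mem hy' hy]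
  exact mem_comp_self hc

lemma isCompact_closure_comp {c : ℝ} {z : ℂ} : IsCompact (closure (comp a v c z)) :=
  (isBounded_green_le (a := a) (v := v) c).subset
    (fun _ h => (mem_sublevel.1 (comp_subset h)).le) |>.isCompact_closure

lemma F_mem_sublevel {c : ℝ} {z : ℂ} : F a v z ∈ sublevel a v (3 * c) ↔ z ∈ sublevel a v c := by
  rw [mem_sublevel, mem_sublevel, green_F]
  constructor <;> intro h <;> linarith

/-- The cubic map sends components of sublevel sets onto components. -/
lemma image_comp {c : ℝ} {z : ℂ} (hz : z ∈ sublevel a v c) :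
    F a v '' comp a v c z = comp a v (3 * c) (F a v z) := by
  apply Set.Subset.antisymm
  · refine subset_comp (isPreconnected_comp.image _ continuous_F.continuousOn)
      ⟨z, mem_comp_self hz, rfl⟩ ?_
    rintro _ ⟨x, hx, rfl⟩
    exact F_mem_sublevel.2 (comp_subset hx)
  -- The image is open. It is also relatively closed: by compactness a limit value is attained on
  -- the closure, and if its level is below `3c`, the preimage lies in the component.
  · refine isPreconnected_comp.subset_of_closure_inter_subset
      (isOpenMap_F _ isOpen_comp) ⟨F a v z, ?_, z, mem_comp_self hz, rfl⟩ ?_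
    · exact mem_comp_self (F_mem_sublevel.2 hz)
    · rintro w ⟨hw, hw'⟩
      have hcl : closure (F a v '' comp a v c z) ⊆ F a v '' closure (comp a v c z) :=
        closure_minimal (Set.image_mono subset_closure)
          (isCompact_closure_comp.image continuous_F).isClosed
      obtain ⟨x, hx, rfl⟩ := hcl hw
      exact ⟨x, mem_comp_of_mem_closure hx (F_mem_sublevel.1 (comp_subset hw')), rfl⟩

/-- Minimum principle: the minimum of `G` on the compact closure lies in the open component, so it
cannot be positive. -/
lemma exists_mem_comp_green_eq_zero {c : ℝ} {z : ℂ} (hz : z ∈ sublevel a v c) :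
    ∃ x ∈ comp a v c z, green a v x = 0 := by
  obtain ⟨p, hp, hmin⟩ := (isCompact_closure_comp (a := a) (v := v) (c := c) (z := z)).exists_isMinOn
    ⟨z, subset_closure (mem_comp_self hz)⟩ continuous_green.continuousOn
  have hpc : p ∈ comp a v c z :=
    mem_comp_of_mem_closure hp
      (mem_sublevel.2 (lt_of_le_of_lt (hmin (subset_closure (mem_comp_self hz))) hz))
  refine ⟨p, hpc, ?_⟩
  by_contra h0
  obtain ⟨x, hx, hlt⟩ := (exists_green_lt_and_gt ((green_nonneg p).lt_of_ne' h0)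
    (isOpen_comp.mem_nhds hpc)).1
  have hle : green a v p ≤ green a v x := hmin (subset_closure hx)
  exact absurd hlt hle.not_gt

/-- Every component meets `{G = 0}`, which lies in a disc. Once `c` exceeds `G` on that disc, the
disc joins all components. -/
lemma exists_isPreconnected_sublevel (a v : ℂ) :
    ∃ C : ℝ, ∀ c, C < c → IsPreconnected (sublevel a v c) := by
  obtain ⟨R, hR⟩ := (isBounded_green_le (a := a) (v := v) 0).subset_closedBall 0
  obtain ⟨C, hC⟩ := (isCompact_closedBall (0 : ℂ) R).bddAbove_image
    (continuous_green (a := a) (v := v)).continuousOn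
  refine ⟨C, fun c hc => ?_⟩
  have hball : Metric.closedBall 0 R ⊆ sublevel a v c := fun x hx =>
    lt_of_le_of_lt (hC ⟨x, hx, rfl⟩) hc
  have hsub : ∀ x ∈ sublevel a v c, ∃ x' ∈ comp a v c x, x' ∈ Metric.closedBall (0 : ℂ) R := by
    intro x hx
    obtain ⟨x', hx', h0⟩ := exists_mem_comp_green_eq_zero hx
    exact ⟨x', hx', hR h0.le⟩
  have heq : ∀ x ∈ sublevel a v c, ∀ y ∈ sublevel a v c, comp a v c x = comp a v c y := by
    intro x hx y hy
    obtain ⟨x', hx', hxb⟩ := hsub x hx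
    obtain ⟨y', hy', hyb⟩ := hsub y hy
    rw [comp_eq hx', comp_eq hy']
    exact comp_eq (subset_comp (convex_closedBall (0 : ℂ) R).isPreconnected hxb hball hyb)
  rcases Set.eq_empty_or_nonempty (sublevel a v c) with h | ⟨x, hx⟩
  · rw [h]; exact isPreconnected_empty
  · have : sublevel a v c = comp a v c x :=
      Set.Subset.antisymm (fun y hy => by rw [heq x hx y hy]; exact mem_comp_self hy) comp_subset
    rw [this]; exact isPreconnected_comp

lemma comp_eq_sublevel {c : ℝ} (h : IsPreconnected (sublevel a v c)) {z : ℂ}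
    (hz : z ∈ sublevel a v c) : comp a v c z = sublevel a v c :=
  Set.Subset.antisymm comp_subset (subset_comp h hz le_rfl)

lemma green_neg_two_mul (ha : green a v a = 0) : green a v (-2 * a) = 0 := by
  have h := green_F (a := a) (v := v) (-2 * a)
  rw [F_neg_two_mul, green_F, ha] at h
  linarith

lemma marked_mem_sublevel (ha : green a v a = 0) {c : ℝ} (hc : 0 < c) : a ∈ sublevel a v c := by
  rwa [mem_sublevel, ha]

lemma neg_two_mul_mem_sublevel (ha : green a v a = 0) {c : ℝ} (hc : 0 < c) : -2 * a ∈ sublevel a v c := by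
  rwa [mem_sublevel, green_neg_two_mul ha]

/-- Each component maps onto the connected set `{G < 3c}`, so it contains a preimage of `F a`. -/
lemma mem_comp_or_mem_comp (ha : green a v a = 0) {c : ℝ} (hc : 0 < c) (hconn : IsPreconnected (sublevel a v (3 * c)))
    {z : ℂ} (hz : z ∈ sublevel a v c) : z ∈ comp a v c a ∨ z ∈ comp a v c (-2 * a) := by
  have h1 : F a v a ∈ F a v '' comp a v c z := by
    rw [image_comp hz, comp_eq_sublevel hconn (F_mem_sublevel.2 hz)]
    exact F_mem_sublevel.2 (marked_mem_sublevel ha hc)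
  obtain ⟨x, hx, hxa⟩ := h1
  rcases eq_or_eq_of_F_eq_marked hxa with rfl | rfl
  · exact Or.inl (mem_comp_comm hz hx)
  · exact Or.inr (mem_comp_comm hz hx)

lemma isPreconnected_sublevel_iff (ha : green a v a = 0) {c : ℝ} (hc : 0 < c)
    (hconn : IsPreconnected (sublevel a v (3 * c))) :
    IsPreconnected (sublevel a v c) ↔ -2 * a ∈ comp a v c a := by
  constructor
  · intro h
    rw [comp_eq_sublevel h (marked_mem_sublevel ha hc)]
    exact neg_two_mul_mem_sublevel ha hc
  · intro h
    have : sublevel a v c = comp a v c a := by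
      refine Set.Subset.antisymm (fun z hz => ?_) comp_subset
      rcases mem_comp_or_mem_comp ha hc hconn hz with h1 | h1
      · exact h1
      · rwa [comp_eq h]
    rw [this]; exact isPreconnected_comp

/-- A level which is not exceeded by any disconnected sublevel set, and lies above the free
critical point, has itself a connected sublevel set. -/
lemma isPreconnected_sublevel_of_forall_gt (ha : green a v a = 0) {c : ℝ} (hc : green a v (-a) < c)
    (h : ∀ c' > c, IsPreconnected (sublevel a v c')) : IsPreconnected (sublevel a v c) := by
  have hc0 : 0 < c := (green_nonneg _).trans_lt hc
  rw [isPreconnected_sublevel_iff ha hc0 (h _ (by linarith))]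
  by_contra hne
  have hcover := fun z => mem_comp_or_mem_comp ha hc0 (h _ (by linarith)) (z := z)
  -- The two closures cover `{G ≤ c}`, since a point of level `c` is not a local minimum.
  have hle : ∀ p, green a v p ≤ c →
      p ∈ closure (comp a v c a) ∪ closure (comp a v c (-2 * a)) := by
    intro p hp
    rw [← closure_union]
    rcases hp.lt_or_eq with hp | rfl
    · exact subset_closure (hcover p hp)
    · rw [mem_closure_iff_nhds]
      intro O hO
      obtain ⟨z, hz, hlt⟩ := (exists_green_lt_and_gt hc0 hO).1
      exact ⟨z, hz, hcover z hlt⟩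
  -- A common point would have level `c`, and local connectedness of `{G < c}` there would join the
  -- two components.
  have hdisj : Disjoint (closure (comp a v c a)) (closure (comp a v c (-2 * a))) := by
    rw [Set.disjoint_left]
    intro p hpA hpB
    have hpc : green a v p = c := by
      refine le_antisymm ?_ ?_
      · exact closure_minimal (fun z hz => (mem_sublevel.1 (comp_subset hz)).le)
          (isClosed_le continuous_green continuous_const) hpA
      · by_contra! hlt
        have h1 := mem_comp_of_mem_closure hpA hlt
        have h2 := mem_comp_of_mem_closure hpB hlt
        rw [comp_eq_of_mem h1 h2] at hne
        exact hne (mem_comp_self (neg_two_mul_mem_sublevel ha hc0))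
    obtain ⟨N, hN, -, hconn⟩ := exists_nhds_isConnected_inter ha (hpc ▸ hc) univ_mem
    obtain ⟨x, hx, hxN⟩ := mem_closure_iff_nhds.1 hpA N hN
    obtain ⟨y, hy, hyN⟩ := mem_closure_iff_nhds.1 hpB N hN
    rw [hpc] at hconn
    have hyx : y ∈ comp a v c x :=
      subset_comp hconn.isPreconnected ⟨hx, comp_subset hxN⟩ Set.inter_subset_right
        ⟨hy, comp_subset hyN⟩
    rw [← comp_eq hxN] at hyx
    apply hne
    rw [comp_eq_of_mem hyx hyN]
    exact mem_comp_self (neg_two_mul_mem_sublevel ha hc0)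
  obtain ⟨OA, OB, hOA, hOB, hA, hB, hO⟩ :=
    SeparatedNhds.of_isCompact_isCompact isCompact_closure_comp isCompact_closure_comp hdisj
  -- The minimum of `G` on the compact set `{G ≤ c + 1} \ (OA ∪ OB)` exceeds `c` and serves as `c'`;
  -- then `OA`, `OB` disconnect `{G < c'}`.
  obtain ⟨c', hc', hc'O⟩ : ∃ c' > c, sublevel a v c' ⊆ OA ∪ OB := by
    have hcomp : IsCompact ({z | green a v z ≤ c + 1} \ (OA ∪ OB)) :=
      (isCompact_green_le _).diff (hOA.union hOB)
    rcases Set.eq_empty_or_nonempty ({z | green a v z ≤ c + 1} \ (OA ∪ OB)) with he | hne'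
    · refine ⟨c + 1, by linarith, fun z hz => ?_⟩
      by_contra hzO
      have : z ∈ ({z | green a v z ≤ c + 1} \ (OA ∪ OB)) :=
        ⟨show green a v z ≤ c + 1 from le_of_lt hz, hzO⟩
      rw [he] at this
      exact this
    · obtain ⟨p, hp, hmin⟩ := hcomp.exists_isMinOn hne' continuous_green.continuousOn
      have hpc : c < green a v p := by
        by_contra! hle'
        rcases hle p hle' with h1 | h1
        · exact hp.2 (Or.inl (hA h1))
        · exact hp.2 (Or.inr (hB h1))
      refine ⟨green a v p, hpc, fun z hz => ?_⟩
      by_contra hzO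
      have : green a v p ≤ green a v z :=
        hmin ⟨show green a v z ≤ c + 1 from (le_of_lt hz).trans hp.1, hzO⟩
      exact absurd hz this.not_gt
  obtain ⟨z, -, hzA, hzB⟩ := h c' hc' OA OB hOA hOB hc'O
    ⟨a, marked_mem_sublevel ha (hc0.trans hc'),
      hA (subset_closure (mem_comp_self (marked_mem_sublevel ha hc0)))⟩
    ⟨-2 * a, neg_two_mul_mem_sublevel ha (hc0.trans hc'),
      hB (subset_closure (mem_comp_self (neg_two_mul_mem_sublevel ha hc0)))⟩
  exact Set.disjoint_left.1 hO hzA hzB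

lemma exists_compact_connected {c : ℝ} {x y z : ℂ} (hx : x ∈ comp a v c z)
    (hy : y ∈ comp a v c z) :
    ∃ Γ ⊆ comp a v c z, IsCompact Γ ∧ IsPreconnected Γ ∧ x ∈ Γ ∧ y ∈ Γ := by
  have hconn : IsConnected (comp a v c z) := ⟨⟨x, hx⟩, isPreconnected_comp⟩
  obtain ⟨γ, hγ⟩ := (isOpen_comp.isConnected_iff_isPathConnected.1 hconn).joinedIn x hx y hy
  refine ⟨Set.range γ, ?_, isCompact_range γ.continuous, isPreconnected_range γ.continuous,
    ⟨0, γ.source⟩, ⟨1, γ.target⟩⟩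
  rintro _ ⟨t, rfl⟩
  exact hγ t

/-- Sublevel sets above the free critical point are connected. -/
theorem isPreconnected_sublevel (ha : green a v a = 0) {c : ℝ} (hc : green a v (-a) < c) :
    IsPreconnected (sublevel a v c) := by
  by_contra hbad
  obtain ⟨C, hC⟩ := exists_isPreconnected_sublevel a v
  set T := {c : ℝ | green a v (-a) < c ∧ ¬ IsPreconnected (sublevel a v c)} with hT
  have hTb : BddAbove T := ⟨C, fun c hc => by
    by_contra! h
    exact hc.2 (hC c h)⟩
  have hcT : c ∈ T := ⟨hc, hbad⟩
  have hlt : green a v (-a) < sSup T := hc.trans_le (le_csSup hTb hcT)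
  have h0 : 0 < sSup T := (green_nonneg _).trans_lt hlt
  have habove : ∀ c' > sSup T, IsPreconnected (sublevel a v c') := by
    intro c' hc'
    by_contra h
    exact absurd (le_csSup hTb ⟨hlt.trans hc', h⟩) hc'.not_ge
  have hsup := isPreconnected_sublevel_of_forall_gt ha hlt habove
  have hmem := (isPreconnected_sublevel_iff ha h0 (habove _ (by linarith))).1 hsup
  -- A compact path from `a` to `-2a` at the level `sSup T` stays below some smaller level, so the
  -- levels just under the supremum are not bad after all.
  obtain ⟨Γ, hΓ, hcpt, hconn, haΓ, hbΓ⟩ :=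
    exists_compact_connected (mem_comp_self (marked_mem_sublevel ha h0)) hmem
  obtain ⟨p, hp, hmax⟩ := hcpt.exists_isMaxOn ⟨a, haΓ⟩
    (continuous_green (a := a) (v := v)).continuousOn
  have hp' : green a v p < sSup T := comp_subset (hΓ hp)
  -- Above `sSup T / 3`, so that `3t` is a good level.
  obtain ⟨t, htT, ht⟩ := exists_lt_of_lt_csSup ⟨c, hcT⟩
    (max_lt hp' (by linarith : sSup T / 3 < sSup T))
  have ht0 : 0 < t := (green_nonneg _).trans_lt htT.1
  have ht3 : sSup T < 3 * t := by linarith [(le_max_right _ _).trans_lt ht]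
  apply htT.2
  rw [isPreconnected_sublevel_iff ha ht0 (habove _ ht3)]
  refine subset_comp hconn haΓ (fun z hz => ?_) hbΓ
  exact lt_of_le_of_lt (hmax hz) ((le_max_left _ _).trans_lt ht)

/-! ### Square roots on compact sets -/

/-- The function `z ↦ z - p` has a continuous square root on `Γ`. -/
def HasSqrtOn (Γ : Set ℂ) (p : ℂ) : Prop :=
  ∃ r : ℂ → ℂ, ContinuousOn r Γ ∧ ∀ z ∈ Γ, r z ^ 2 = z - p

/-- A square root that is continuous off the negative real axis. -/
noncomputable def halfExp (z : ℂ) : ℂ := Complex.exp (Complex.log z / 2)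

lemma halfExp_sq {z : ℂ} (hz : z ≠ 0) : halfExp z ^ 2 = z := by
  rw [halfExp, ← Complex.exp_nat_mul]
  push_cast
  rw [mul_div_cancel₀ _ two_ne_zero, Complex.exp_log hz]

lemma halfExp_ne_zero (z : ℂ) : halfExp z ≠ 0 := Complex.exp_ne_zero _

lemma continuousOn_halfExp : ContinuousOn halfExp Complex.slitPlane := fun _ hz =>
  (((continuousAt_id.clog hz).div_const 2).cexp).continuousWithinAt

lemma re_halfExp_pos {z : ℂ} (hz : z ∈ Complex.slitPlane) : 0 < (halfExp z).re := by
  rw [halfExp, Complex.exp_re]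
  refine mul_pos (Real.exp_pos _) (Real.cos_pos_of_mem_Ioo ?_)
  have him : (Complex.log z / 2).im = z.arg / 2 := by
    rw [show Complex.log z / 2 = Complex.log z / ((2 : ℝ) : ℂ) by norm_num,
      Complex.div_ofReal_im, Complex.log_im]
  rw [him]
  have h1 := Complex.neg_pi_lt_arg z
  have h2 := (Complex.arg_le_pi z).lt_of_ne (Complex.mem_slitPlane_iff_arg.1 hz).1
  constructor <;> linarith

lemma HasSqrtOn.of_ratio {Γ : Set ℂ} {p q : ℂ} (h : HasSqrtOn Γ p) {ρ : ℂ → ℂ}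
    (hρ : ContinuousOn ρ Γ) (hmul : ∀ z ∈ Γ, (z - p) * ρ z ^ 2 = z - q) : HasSqrtOn Γ q := by
  obtain ⟨r, hr, hr2⟩ := h
  exact ⟨fun z => r z * ρ z, hr.mul hρ, fun z hz => by rw [mul_pow, hr2 z hz, hmul z hz]⟩

lemma continuousOn_halfExp_one_add {Γ : Set ℂ} {f : ℂ → ℂ} (hf : ContinuousOn f Γ)
    (hlt : ∀ z ∈ Γ, ‖f z‖ < 1) : ContinuousOn (fun z => halfExp (1 + f z)) Γ :=
  continuousOn_halfExp.comp (continuousOn_const.add hf) fun z hz => one_add_mem_slitPlane (hlt z hz)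

lemma ne_zero_of_norm_lt_one {w : ℂ} (hw : ‖w‖ < 1) : 1 + w ≠ 0 :=
  Complex.slitPlane_ne_zero (one_add_mem_slitPlane hw)

/-- `z - q = (z - p) (1 + (p - q)/(z - p))`, and the second factor avoids the branch cut. -/
lemma HasSqrtOn.of_dist_lt {Γ : Set ℂ} {p q : ℂ} (h : HasSqrtOn Γ p)
    (hpq : ∀ z ∈ Γ, ‖p - q‖ < ‖z - p‖) : HasSqrtOn Γ q := by
  have hne : ∀ z ∈ Γ, z - p ≠ 0 := fun z hz h0 => by
    have := hpq z hz
    rw [h0, norm_zero] at this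
    exact absurd this (norm_nonneg _).not_gt
  have hlt : ∀ z ∈ Γ, ‖(p - q) / (z - p)‖ < 1 := fun z hz => by
    rw [norm_div, div_lt_one (norm_pos_iff.2 (hne z hz))]
    exact hpq z hz
  have hcont : ContinuousOn (fun z => (p - q) / (z - p)) Γ :=
    continuousOn_const.div (continuousOn_id.sub continuousOn_const) hne
  refine h.of_ratio (continuousOn_halfExp_one_add hcont hlt) fun z hz => ?_
  rw [halfExp_sq (ne_zero_of_norm_lt_one (hlt z hz))]
  have := hne z hz
  field_simp
  ring

lemma hasSqrtOn_of_norm_lt {Γ : Set ℂ} {p : ℂ} (h : ∀ z ∈ Γ, ‖z‖ < ‖p‖) : HasSqrtOn Γ p := by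
  rcases eq_or_ne p 0 with rfl | hp
  · refine ⟨fun _ => 0, continuousOn_const, fun z hz => ?_⟩
    have := h z hz
    rw [norm_zero] at this
    exact absurd this (norm_nonneg _).not_gt
  have hlt : ∀ z ∈ Γ, ‖-z / p‖ < 1 := fun z hz => by
    rw [norm_div, norm_neg, div_lt_one (norm_pos_iff.2 hp)]
    exact h z hz
  have hcont : ContinuousOn (fun z => -z / p) Γ := continuousOn_id.neg.div_const p
  refine ⟨fun z => halfExp (-p) * halfExp (1 + -z / p),
    continuousOn_const.mul (continuousOn_halfExp_one_add hcont hlt), fun z hz => ?_⟩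
  rw [mul_pow, halfExp_sq (neg_ne_zero.2 hp), halfExp_sq (ne_zero_of_norm_lt_one (hlt z hz))]
  field_simp
  ring

/-- If `z - p` has no continuous square root on the compact set `Γ`, then `Γ` separates `p` from
infinity. -/
lemma isBounded_component_of_not_hasSqrtOn {Γ : Set ℂ} (hΓ : IsCompact Γ) {p : ℂ} (hp : p ∉ Γ)
    (h : ¬ HasSqrtOn Γ p) : Bornology.IsBounded (connectedComponentIn Γᶜ p) := by
  rcases Set.eq_empty_or_nonempty Γ with rfl | hne
  · exact absurd ⟨fun _ => 0, continuousOn_empty _, fun z hz => absurd hz (Set.notMem_empty z)⟩ h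
  set D := connectedComponentIn Γᶜ p with hD
  have hDΓ : D ⊆ Γᶜ := connectedComponentIn_subset _ _
  have hpD : p ∈ D := mem_connectedComponentIn hp
  -- Having a square root is locally constant in `q` off `Γ`, hence constant on `D`; far from `Γ` a
  -- root always exists, so `D` is bounded.
  have hloc : ∀ q ∉ Γ, ∀ᶠ q' in 𝓝 q, (HasSqrtOn Γ q ↔ HasSqrtOn Γ q') := by
    intro q hq
    have hpos : 0 < Metric.infDist q Γ := (hΓ.isClosed.notMem_iff_infDist_pos hne).1 hq
    filter_upwards [Metric.ball_mem_nhds q (half_pos hpos)] with q' hq'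
    rw [Metric.mem_ball, dist_eq_norm] at hq'
    have hz : ∀ z ∈ Γ, Metric.infDist q Γ ≤ ‖z - q‖ := fun z hz => by
      have := Metric.infDist_le_dist_of_mem (x := q) hz
      rwa [dist_comm, dist_eq_norm] at this
    constructor
    · intro h
      refine h.of_dist_lt fun z hz' => ?_
      rw [norm_sub_rev]
      linarith [hz z hz']
    · intro h
      refine h.of_dist_lt fun z hz' => ?_
      have h1 : ‖z - q‖ ≤ ‖z - q'‖ + ‖q' - q‖ := norm_sub_le_norm_sub_add_norm_sub z q' q
      linarith [hz z hz']
  have hno : ∀ q ∈ D, ¬ HasSqrtOn Γ q := by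
    have hsub : D ⊆ {q | q ∉ Γ ∧ ¬ HasSqrtOn Γ q} := by
      refine isPreconnected_connectedComponentIn.subset_left_of_subset_union
        (v := {q | q ∉ Γ ∧ HasSqrtOn Γ q}) ?_ ?_ ?_ ?_ ⟨p, hpD, hp, h⟩
      · rw [isOpen_iff_mem_nhds]
        rintro q ⟨hq, hq'⟩
        filter_upwards [hloc q hq, hΓ.isClosed.isOpen_compl.mem_nhds hq] with x hx hx'
        exact ⟨hx', fun hh => hq' (hx.2 hh)⟩
      · rw [isOpen_iff_mem_nhds]
        rintro q ⟨hq, hq'⟩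
        filter_upwards [hloc q hq, hΓ.isClosed.isOpen_compl.mem_nhds hq] with x hx hx'
        exact ⟨hx', hx.1 hq'⟩
      · rw [Set.disjoint_left]
        rintro q ⟨-, h1⟩ ⟨-, h2⟩
        exact h1 h2
      · intro q hq
        by_cases hs : HasSqrtOn Γ q
        · exact Or.inr ⟨hDΓ hq, hs⟩
        · exact Or.inl ⟨hDΓ hq, hs⟩
    exact fun q hq => (hsub hq).2
  obtain ⟨M, hM⟩ := hΓ.isBounded.exists_norm_le
  refine (Metric.isBounded_closedBall (x := (0 : ℂ)) (r := M)).subset fun q hq => ?_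
  by_contra hqM
  rw [mem_closedBall_zero_iff, not_le] at hqM
  exact hno q hq (hasSqrtOn_of_norm_lt fun z hz => (hM z hz).trans_lt hqM)

lemma closure_component_subset {Γ : Set ℂ} (hΓ : IsClosed Γ) (p : ℂ) :
    closure (connectedComponentIn Γᶜ p) ⊆ connectedComponentIn Γᶜ p ∪ Γ := by
  intro q hq
  by_contra hq'
  rw [Set.mem_union, not_or] at hq'
  have hopen : IsOpen (connectedComponentIn Γᶜ q) := hΓ.isOpen_compl.connectedComponentIn
  obtain ⟨y, hy, hy'⟩ := mem_closure_iff.1 hq _ hopen (mem_connectedComponentIn hq'.2)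
  apply hq'.1
  rw [connectedComponentIn_eq hy', ← connectedComponentIn_eq hy]
  exact mem_connectedComponentIn hq'.2

/-- Maximum principle for the Green's function, on the complementary components of a compact
set. -/
lemma green_le_of_isBounded_component {Γ : Set ℂ} (hΓ : IsCompact Γ) {p : ℂ} {c : ℝ} (hc : 0 ≤ c)
    (hD : Bornology.IsBounded (connectedComponentIn Γᶜ p)) (hle : ∀ z ∈ Γ, green a v z ≤ c) :
    ∀ z ∈ connectedComponentIn Γᶜ p, green a v z ≤ c := by
  intro z hz
  obtain ⟨q, hq, hmax⟩ := hD.isCompact_closure.exists_isMaxOn ⟨z, subset_closure hz⟩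
    (continuous_green (a := a) (v := v)).continuousOn
  refine (show green a v z ≤ green a v q from hmax (subset_closure hz)).trans ?_
  by_contra! hlt
  rcases closure_component_subset hΓ.isClosed p hq with hqD | hqΓ
  · obtain ⟨x, hx, hgt⟩ := (exists_green_lt_and_gt (hc.trans_lt hlt)
      ((hΓ.isClosed.isOpen_compl.connectedComponentIn).mem_nhds hqD)).2
    exact absurd (show green a v x ≤ green a v q from hmax (subset_closure hx)) hgt.not_ge
  · exact absurd (hle q hqΓ) hlt.not_ge

lemma hasSqrtOn_of_green_lt {Γ : Set ℂ} (hΓ : IsCompact Γ) {p : ℂ} {c : ℝ} (hc : 0 ≤ c)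
    (hle : ∀ z ∈ Γ, green a v z ≤ c) (hp : c < green a v p) : HasSqrtOn Γ p := by
  by_contra h
  have hpΓ : p ∉ Γ := fun hmem => absurd (hle p hmem) hp.not_ge
  exact absurd (green_le_of_isBounded_component hΓ hc
    (isBounded_component_of_not_hasSqrtOn hΓ hpΓ h) hle p (mem_connectedComponentIn hpΓ)) hp.not_ge

/-- Components of sublevel sets do not separate the plane. -/
lemma hasSqrtOn_of_notMem_comp {Γ : Set ℂ} (hΓ : IsCompact Γ) {p z : ℂ} {c : ℝ}
    (hsub : Γ ⊆ comp a v c z) (hp : p ∉ comp a v c z) : HasSqrtOn Γ p := by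
  by_contra h
  have hpΓ : p ∉ Γ := fun hmem => hp (hsub hmem)
  have hpD := mem_connectedComponentIn (F := Γᶜ) hpΓ
  have hne : Γ.Nonempty := by
    by_contra! hemp
    exact h ⟨fun _ => 0, hemp ▸ continuousOn_empty _, fun z hz => by simp [hemp] at hz⟩
  obtain ⟨m, hm, hmax⟩ := hΓ.exists_isMaxOn hne (continuous_green (a := a) (v := v)).continuousOn
  have hb := isBounded_component_of_not_hasSqrtOn hΓ hpΓ h
  have hle := green_le_of_isBounded_component hΓ (green_nonneg m) hb fun z hz => hmax hz
  have hmc : green a v m < c := comp_subset (hsub hm)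
  have hcl := closure_component_subset hΓ.isClosed p
  -- This closure is connected, contains `p`, meets `Γ` and stays in `{G < c}`, so it would put `p`
  -- into the component.
  have hclc : closure (connectedComponentIn Γᶜ p) ⊆ sublevel a v c := by
    intro x hx
    rcases hcl hx with hx | hx
    · exact lt_of_le_of_lt (hle x hx) hmc
    · exact comp_subset (hsub hx)
  have hmeet : (closure (connectedComponentIn Γᶜ p) ∩ Γ).Nonempty := by
    by_contra! hemp
    have hclosed : IsClosed (connectedComponentIn Γᶜ p) := by
      refine isClosed_of_closure_subset fun x hx => (hcl hx).resolve_right fun hxΓ => ?_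
      exact Set.notMem_empty x (hemp ▸ ⟨hx, hxΓ⟩)
    have huniv := IsClopen.eq_univ ⟨hclosed, hΓ.isClosed.isOpen_compl.connectedComponentIn⟩
      ⟨p, hpD⟩
    exact connectedComponentIn_subset _ _ (huniv ▸ Set.mem_univ m : m ∈ connectedComponentIn Γᶜ p) hm
  obtain ⟨x, hx, hxΓ⟩ := hmeet
  apply hp
  rw [comp_eq (hsub hxΓ)]
  exact subset_comp isPreconnected_connectedComponentIn.closure hx hclc (subset_closure hpD)

/-! ### The saddle of the Green's function at the free critical point -/

lemma marked_ne_zero (ha : green a v a = 0) (hg : 0 < green a v (-a)) : a ≠ 0 := by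
  rintro rfl
  rw [neg_zero, ha] at hg
  exact lt_irrefl _ hg

/-- `F` has a simple critical point at `-a`, so along `-a + z e` the local coordinate `f` at `F(-a)`
reads `f q (1 - z²) + o(z²)`. Its modulus drops for real `z` and rises for imaginary `z`. -/
lemma exists_saddle (ha : green a v a = 0) (hg : 0 < green a v (-a)) :
    ∃ e : ℂ, e ≠ 0 ∧ ∃ ρ : ℝ, 0 < ρ ∧ ∀ τ : ℝ, τ ≠ 0 → |τ| ≤ ρ →
      green a v (-a + τ * e) < green a v (-a) ∧
      green a v (-a) < green a v (-a + τ * Complex.I * e) := by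
  have ha0 := marked_ne_zero ha hg
  set q := F a v (-a) with hq
  have hq3 : green a v q = 3 * green a v (-a) := green_F _
  have hcrit : ∀ k, (F a v)^[k] q ≠ a ∧ (F a v)^[k] q ≠ -a := by
    intro k
    have hk : 3 * green a v (-a) ≤ green a v ((F a v)^[k] q) := by
      rw [green_iterate, hq3]
      exact le_mul_of_one_le_left (by linarith) (one_le_pow₀ (by norm_num))
    constructor
    · intro h; rw [h, ha] at hk; linarith
    · intro h; rw [h] at hk; linarith
  obtain ⟨n, f, d, hd, hf, hnorm⟩ := exists_conformal_coordinate (p := q) (by linarith) hcrit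
  have hfq : f q ≠ 0 := by rw [← norm_pos_iff, hnorm.self_of_nhds]; positivity
  -- Chosen so that the quadratic coefficient `-3 a d e²` equals `-f q`.
  set e := halfExp (f q / (3 * a * d)) with he
  have he2 : e ^ 2 = f q / (3 * a * d) :=
    halfExp_sq (div_ne_zero hfq (mul_ne_zero (mul_ne_zero three_ne_zero ha0) hd))
  have he0 : e ≠ 0 := halfExp_ne_zero _
  have htend : Tendsto (fun z : ℂ => F a v (-a + z * e)) (𝓝 0) (𝓝 q) := by
    have h : Continuous fun z : ℂ => F a v (-a + z * e) := continuous_F.comp (by fun_prop)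
    simpa [hq] using h.tendsto 0
  have hη : ∀ z : ℂ, F a v (-a + z * e) - q = z ^ 2 * (e ^ 2 * (z * e - 3 * a)) := by
    intro z
    rw [hq, F_sub_free]; ring
  have hO : (fun z : ℂ => F a v (-a + z * e) - q) =O[𝓝 0] fun z => z ^ 2 := by
    have h1 : (fun z : ℂ => e ^ 2 * (z * e - 3 * a)) =O[𝓝 0] fun _ => (1 : ℂ) := by
      have h : Continuous fun z : ℂ => e ^ 2 * (z * e - 3 * a) := by fun_prop
      exact h.continuousAt.isBigO_one ℂ
    have h2 := (isBigO_refl (fun z : ℂ => z ^ 2) (𝓝 0)).mul h1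
    simp only [mul_one] at h2
    exact h2.congr_left fun z => (hη z).symm
  have ho1 : (fun z : ℂ => f (F a v (-a + z * e)) - f q - (F a v (-a + z * e) - q) * d)
      =o[𝓝 0] fun z => z ^ 2 := by
    have h1 := (hasDerivAt_iff_isLittleO.1 hf.hasDerivAt).comp_tendsto htend
    simp only [Function.comp_def, smul_eq_mul] at h1
    exact h1.trans_isBigO hO
  have ho2 : (fun z : ℂ => d * e ^ 3 * z ^ 3) =o[𝓝 0] fun z => z ^ 2 :=
    (isLittleO_pow_pow (𝕜 := ℂ) (by norm_num : 2 < 3)).const_mul_left _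
  have ho : (fun z : ℂ => f (F a v (-a + z * e)) - f q * (1 - z ^ 2)) =o[𝓝 0] fun z => z ^ 2 := by
    refine (ho1.add ho2).congr_left fun z => ?_
    rw [hη z]
    have h1 : 3 * a * d * e ^ 2 = f q := by
      rw [he2]; field_simp
    linear_combination z ^ 2 * h1
  have hsmall := ho.def (half_pos (norm_pos_iff.2 hfq))
  obtain ⟨δ, hδ, hball⟩ := Metric.eventually_nhds_iff.1 (hsmall.and (htend.eventually hnorm))
  have hlevel : ∀ z : ℂ, ‖z‖ < δ →
      ‖f (F a v (-a + z * e)) - f q * (1 - z ^ 2)‖ ≤ ‖f q‖ / 2 * ‖z‖ ^ 2 ∧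
      ‖f (F a v (-a + z * e))‖ = Real.exp (3 ^ n * (3 * green a v (-a + z * e))) := by
    intro z hz
    have := hball (y := z) (by simpa using hz)
    rw [norm_pow, green_F] at this
    exact this
  have hfqn : ‖f q‖ = Real.exp (3 ^ n * (3 * green a v (-a))) := by
    rw [hnorm.self_of_nhds, hq3]
  have hfpos := norm_pos_iff.2 hfq
  have h3n : (0 : ℝ) < 3 ^ n := by positivity
  refine ⟨e, he0, min (δ / 2) 1, by positivity, fun τ hτ hτρ => ?_⟩
  have hτδ : |τ| < δ := by linarith [min_le_left (δ / 2) 1]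
  have hτ1 : |τ| ≤ 1 := hτρ.trans (min_le_right _ _)
  have hτ2 : 0 < τ ^ 2 := by positivity
  have hτ2' : τ ^ 2 ≤ 1 := by rw [← sq_abs]; exact pow_le_one₀ (abs_nonneg _) hτ1
  constructor
  · obtain ⟨h1, h2⟩ := hlevel (τ : ℂ) (by simpa using hτδ)
    have h3 : ‖f q * (1 - (τ : ℂ) ^ 2)‖ = ‖f q‖ * (1 - τ ^ 2) := by
      rw [norm_mul, show (1 - (τ : ℂ) ^ 2) = ((1 - τ ^ 2 : ℝ) : ℂ) by push_cast; rfl,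
        Complex.norm_real, Real.norm_of_nonneg (by linarith)]
    rw [Complex.norm_real, Real.norm_eq_abs, sq_abs] at h1
    have h4 := norm_sub_norm_le (f (F a v (-a + τ * e))) (f q * (1 - (τ : ℂ) ^ 2))
    have h5 : ‖f (F a v (-a + τ * e))‖ < ‖f q‖ := by nlinarith
    rw [h2, hfqn, Real.exp_lt_exp] at h5
    linarith [lt_of_mul_lt_mul_left h5 h3n.le]
  · obtain ⟨h1, h2⟩ := hlevel (τ * Complex.I) (by simpa using hτδ)
    have h3 : ‖f q * (1 - (τ * Complex.I) ^ 2)‖ = ‖f q‖ * (1 + τ ^ 2) := by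
      rw [norm_mul, show (1 - (τ * Complex.I) ^ 2) = ((1 + τ ^ 2 : ℝ) : ℂ) by
        rw [mul_pow, Complex.I_sq]; push_cast; ring,
        Complex.norm_real, Real.norm_of_nonneg (by linarith)]
    rw [norm_mul, Complex.norm_I, mul_one, Complex.norm_real, Real.norm_eq_abs, sq_abs] at h1
    have h4 := norm_sub_norm_le (f q * (1 - (τ * Complex.I) ^ 2))
      (f (F a v (-a + τ * Complex.I * e)))
    rw [norm_sub_rev] at h4
    have h5 : ‖f q‖ < ‖f (F a v (-a + τ * Complex.I * e))‖ := by nlinarith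
    rw [h2, hfqn, Real.exp_lt_exp] at h5
    linarith [lt_of_mul_lt_mul_left h5 h3n.le]

/-- A crossing argument: if a compact connected set joins the ends of the segment
`{p + τe : |τ| ≤ ρ}` without meeting `p`, then together with the segment it separates the points
`p ± iεe` for small `ε`, in the sense that `z - p - iεe` and `z - p + iεe` cannot both have
continuous square roots on it. -/
lemma not_hasSqrtOn_of_crossing {Γ : Set ℂ} (hΓ : IsCompact Γ) (hconn : IsPreconnected Γ)
    {p e : ℂ} (he : e ≠ 0) {ρ : ℝ} (hρ : 0 < ρ) (hp : p ∉ Γ) (h1 : p + ρ * e ∈ Γ)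
    (h2 : p - ρ * e ∈ Γ) : ∃ ε : ℝ, 0 < ε ∧ ε ≤ ρ ∧
      ¬ (HasSqrtOn (Γ ∪ (fun τ : ℝ => p + τ * e) '' Set.Icc (-ρ) ρ) (p + ε * Complex.I * e) ∧
        HasSqrtOn (Γ ∪ (fun τ : ℝ => p + τ * e) '' Set.Icc (-ρ) ρ) (p - ε * Complex.I * e)) := by
  have hepos := norm_pos_iff.2 he
  have hdist : 0 < Metric.infDist p Γ := (hΓ.isClosed.notMem_iff_infDist_pos ⟨_, h1⟩).1 hp
  set δ := Metric.infDist p Γ with hδ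
  have hεpos : 0 < min ρ (δ / (4 * ‖e‖)) := by positivity
  refine ⟨min ρ (δ / (4 * ‖e‖)), hεpos, min_le_left _ _, ?_⟩
  have hεδ : min ρ (δ / (4 * ‖e‖)) * ‖e‖ ≤ δ / 4 := by
    have := mul_le_mul_of_nonneg_right (min_le_right ρ (δ / (4 * ‖e‖))) hepos.le
    rwa [show δ / (4 * ‖e‖) * ‖e‖ = δ / 4 by field_simp] at this
  set ε := min ρ (δ / (4 * ‖e‖)) with hε
  rintro ⟨⟨r₁, hr₁, hs₁⟩, ⟨r₂, hr₂, hs₂⟩⟩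
  set S := (fun τ : ℝ => p + τ * e) '' Set.Icc (-ρ) ρ with hS
  have hnormε : ‖(ε : ℂ) * Complex.I * e‖ = ε * ‖e‖ := by
    rw [norm_mul, norm_mul, Complex.norm_I, Complex.norm_real, Real.norm_of_nonneg hεpos.le,
      mul_one]
  have hfar : ∀ z ∈ Γ, 3 / 4 * δ ≤ ‖z - (p - ε * Complex.I * e)‖ := by
    intro z hz
    have h3 : δ ≤ ‖z - p‖ := by
      have := Metric.infDist_le_dist_of_mem (x := p) hz
      rwa [dist_comm, dist_eq_norm] at this
    have h4 := norm_sub_norm_le (z - p) (-(ε * Complex.I * e))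
    rw [norm_neg, hnormε] at h4
    rw [show z - (p - ε * Complex.I * e) = z - p - -(ε * Complex.I * e) by ring]
    linarith
  have hneΓ : ∀ z ∈ Γ, z - (p - ε * Complex.I * e) ≠ 0 := fun z hz h0 => by
    have := hfar z hz
    rw [h0, norm_zero] at this
    linarith
  have hr₂ne : ∀ z ∈ Γ, r₂ z ≠ 0 := fun z hz h0 => by
    have := hs₂ z (Or.inl hz)
    rw [h0] at this
    exact hneΓ z hz (by rw [← this]; ring)
  set w : ℂ → ℂ := fun z => -(2 * (ε * Complex.I * e)) / (z - (p - ε * Complex.I * e)) with hw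
  have hwlt : ∀ z ∈ Γ, ‖w z‖ < 1 := by
    intro z hz
    rw [hw]
    simp only
    rw [norm_div, norm_neg, norm_mul, hnormε, Complex.norm_ofNat,
      div_lt_one (norm_pos_iff.2 (hneΓ z hz))]
    linarith [hfar z hz]
  have hwcont : ContinuousOn w Γ :=
    continuousOn_const.div (continuousOn_id.sub continuousOn_const) hneΓ
  have hψcont := continuousOn_halfExp_one_add hwcont hwlt
  -- On the connected `Γ`, `r₁ / r₂` is a constant sign times `halfExp (1 + w)`, so its real part
  -- never changes sign.
  have hΓsign := hconn.eq_or_eq_neg_of_sq_eq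
    (f := r₁) (g := fun z => halfExp (1 + w z) * r₂ z)
    (hr₁.mono Set.subset_union_left) (hψcont.mul (hr₂.mono Set.subset_union_left)) (by
      intro z hz
      simp only [Pi.pow_apply]
      rw [mul_pow, halfExp_sq (ne_zero_of_norm_lt_one (hwlt z hz)), hs₁ z (Or.inl hz),
        hs₂ z (Or.inl hz), hw]
      have := hneΓ z hz
      field_simp
      ring) (fun {z} hz => mul_ne_zero (halfExp_ne_zero _) (hr₂ne z hz))
  have hIcont : ContinuousOn (fun τ : ℝ => p + (τ : ℂ) * e) (Set.Icc (-ρ) ρ) := by fun_prop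
  have hmaps : Set.MapsTo (fun τ : ℝ => p + (τ : ℂ) * e) (Set.Icc (-ρ) ρ) (Γ ∪ S) :=
    fun τ hτ => Or.inr ⟨τ, hτ, rfl⟩
  have hτne : ∀ τ : ℝ, (τ : ℂ) + ε * Complex.I ≠ 0 := fun τ h0 => by
    have := congrArg Complex.im h0
    simp at this
    exact hεpos.ne' this
  have hτne' : ∀ τ : ℝ, (τ : ℂ) - ε * Complex.I ≠ 0 := fun τ h0 => by
    have := congrArg Complex.im h0
    simp at this
    exact hεpos.ne' this
  have hsqrt : ∀ τ : ℝ, 0 < Real.sqrt (τ ^ 2 + ε ^ 2) := fun τ => Real.sqrt_pos.2 (by positivity)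
  have hsqrt2 : ∀ τ : ℝ, ((Real.sqrt (τ ^ 2 + ε ^ 2) : ℝ) : ℂ) ^ 2 =
      ((τ : ℂ) - ε * Complex.I) * (τ + ε * Complex.I) := fun τ => by
    rw [← Complex.ofReal_pow, Real.sq_sqrt (by positivity)]
    push_cast
    linear_combination (ε : ℂ) ^ 2 * Complex.I_sq
  have hr₂S : ∀ τ ∈ Set.Icc (-ρ) ρ, r₂ (p + (τ : ℂ) * e) ≠ 0 := fun τ hτ h0 => by
    have := hs₂ _ (hmaps hτ)
    rw [h0] at this
    refine mul_ne_zero he (hτne τ) ?_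
    linear_combination -this
  -- On the segment, `r₁ / r₂` is a constant sign times `(τ - iε)/√(τ² + ε²)`, whose real part has
  -- opposite signs at the two ends. Those ends lie in `Γ`: contradiction.
  have hSsign := (isPreconnected_Icc (a := -ρ) (b := ρ)).eq_or_eq_neg_of_sq_eq
    (f := fun τ : ℝ => ((Real.sqrt (τ ^ 2 + ε ^ 2) : ℝ) : ℂ) * r₁ (p + (τ : ℂ) * e))
    (g := fun τ : ℝ => ((τ : ℂ) - ε * Complex.I) * r₂ (p + (τ : ℂ) * e))
    (by
      refine ContinuousOn.mul ?_ (hr₁.comp hIcont hmaps)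
      exact (Complex.continuous_ofReal.comp
        (Real.continuous_sqrt.comp (by fun_prop))).continuousOn)
    (by
      refine ContinuousOn.mul (by fun_prop) (hr₂.comp hIcont hmaps)) (by
      intro τ hτ
      simp only [Pi.pow_apply]
      rw [mul_pow, mul_pow, hs₁ _ (hmaps hτ), hs₂ _ (hmaps hτ), hsqrt2]
      ring) (fun {τ} hτ => mul_ne_zero (hτne' τ) (hr₂S τ hτ))
  have hre : ∀ z ∈ Γ, 0 < (halfExp (1 + w z)).re := fun z hz =>
    re_halfExp_pos (one_add_mem_slitPlane (hwlt z hz))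
  have hρmem : ρ ∈ Set.Icc (-ρ) ρ := ⟨by linarith, le_rfl⟩
  have hρmem' : -ρ ∈ Set.Icc (-ρ) ρ := ⟨le_rfl, by linarith⟩
  have hx₂ : p - ρ * e = p + ((-ρ : ℝ) : ℂ) * e := by push_cast; ring
  rw [hx₂] at h2
  have key : ∀ τ : ℝ, p + (τ : ℂ) * e ∈ Γ → ∀ κ κ' : ℝ,
      r₁ (p + τ * e) = κ * (halfExp (1 + w (p + τ * e)) * r₂ (p + τ * e)) →
      ((Real.sqrt (τ ^ 2 + ε ^ 2) : ℝ) : ℂ) * r₁ (p + τ * e) =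
        κ' * (((τ : ℂ) - ε * Complex.I) * r₂ (p + τ * e)) →
      Real.sqrt (τ ^ 2 + ε ^ 2) * κ * (halfExp (1 + w (p + τ * e))).re = κ' * τ := by
    intro τ hτ κ κ' hκ hκ'
    rw [hκ] at hκ'
    have h3 : ((Real.sqrt (τ ^ 2 + ε ^ 2) * κ : ℝ) : ℂ) * halfExp (1 + w (p + τ * e)) =
        (κ' : ℂ) * ((τ : ℂ) - ε * Complex.I) := by
      apply mul_right_cancel₀ (hr₂ne _ hτ)
      push_cast
      linear_combination hκ'
    have h4 := congrArg Complex.re h3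
    rw [Complex.re_ofReal_mul, Complex.re_ofReal_mul] at h4
    simpa using h4
  have hkey : ∀ κ κ' : ℝ, κ ≠ 0 →
      (∀ z ∈ Γ, r₁ z = κ * (halfExp (1 + w z) * r₂ z)) →
      (∀ τ ∈ Set.Icc (-ρ) ρ, ((Real.sqrt (τ ^ 2 + ε ^ 2) : ℝ) : ℂ) * r₁ (p + τ * e) =
        κ' * (((τ : ℂ) - ε * Complex.I) * r₂ (p + τ * e))) → False := by
    intro κ κ' hκ hΓ' hS'
    have e1 := key ρ h1 κ κ' (hΓ' _ h1) (hS' ρ hρmem)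
    have e2 := key (-ρ) h2 κ κ' (hΓ' _ h2) (hS' (-ρ) hρmem')
    have p1 := mul_pos (hsqrt ρ) (hre _ h1)
    have p2 := mul_pos (hsqrt (-ρ)) (hre _ h2)
    have hsum : κ * (Real.sqrt (ρ ^ 2 + ε ^ 2) * (halfExp (1 + w (p + (ρ : ℂ) * e))).re +
        Real.sqrt ((-ρ) ^ 2 + ε ^ 2) *
          (halfExp (1 + w (p + ((-ρ : ℝ) : ℂ) * e))).re) = 0 := by
      linear_combination e1 + e2
    rcases mul_eq_zero.1 hsum with h | h
    · exact hκ h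
    · linarith
  rcases hΓsign with hA | hA <;> rcases hSsign with hB | hB
  · exact hkey 1 1 one_ne_zero (fun z hz => by simpa using hA hz) fun τ hτ => by simpa using hB hτ
  · exact hkey 1 (-1) one_ne_zero (fun z hz => by simpa using hA hz) fun τ hτ => by
      simpa using hB hτ
  · exact hkey (-1) 1 (by norm_num) (fun z hz => by simpa using hA hz) fun τ hτ => by
      simpa using hB hτ
  · exact hkey (-1) (-1) (by norm_num) (fun z hz => by simpa using hA hz) fun τ hτ => by
      simpa using hB hτ

/-- At the level of the free critical point, the marked critical point and its cocritical point
lie in different components. -/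
theorem cocritical_notMem_comp (ha : green a v a = 0) (hg : 0 < green a v (-a)) :
    -2 * a ∉ comp a v (green a v (-a)) a := by
  intro hmem
  have hconn3 : IsPreconnected (sublevel a v (3 * green a v (-a))) :=
    isPreconnected_sublevel ha (by linarith)
  have hconn := (isPreconnected_sublevel_iff ha hg hconn3).2 hmem
  have hcomp := comp_eq_sublevel hconn (marked_mem_sublevel ha hg)
  obtain ⟨e, he, ρ, hρ, hsaddle⟩ := exists_saddle ha hg
  have hx₁ : -a + ρ * e ∈ comp a v (green a v (-a)) a := by
    rw [hcomp]
    exact (hsaddle ρ hρ.ne' (abs_of_pos hρ).le).1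
  have hx₂ : -a - ρ * e ∈ comp a v (green a v (-a)) a := by
    rw [hcomp]
    have := (hsaddle (-ρ) (neg_ne_zero.2 hρ.ne') (by rw [abs_neg, abs_of_pos hρ])).1
    rwa [Complex.ofReal_neg, neg_mul, ← sub_eq_add_neg] at this
  -- A path below the critical level joins the two low sides of the saddle. Closed up by the segment
  -- it stays at level at most `G(-a)`, so by the maximum principle square roots exist at the high
  -- points on both sides, against the crossing lemma.
  obtain ⟨Γ, hΓsub, hΓ, hΓconn, h1, h2⟩ := exists_compact_connected hx₁ hx₂
  have hΓlt : ∀ z ∈ Γ, green a v z < green a v (-a) := fun z hz => comp_subset (hΓsub hz)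
  obtain ⟨ε, hε, hερ, hnot⟩ := not_hasSqrtOn_of_crossing hΓ hΓconn he hρ
    (fun h => lt_irrefl _ (hΓlt _ h)) h1 h2
  have hcpt : IsCompact (Γ ∪ (fun τ : ℝ => -a + (τ : ℂ) * e) '' Set.Icc (-ρ) ρ) :=
    hΓ.union (isCompact_Icc.image (by fun_prop))
  have hle : ∀ z ∈ Γ ∪ (fun τ : ℝ => -a + (τ : ℂ) * e) '' Set.Icc (-ρ) ρ,
      green a v z ≤ green a v (-a) := by
    rintro z (hz | ⟨τ, hτ, rfl⟩)
    · exact (hΓlt z hz).le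
    · rcases eq_or_ne τ 0 with rfl | hτ0
      · simp
      · exact (hsaddle τ hτ0 (abs_le.2 hτ)).1.le
  refine hnot ⟨hasSqrtOn_of_green_lt hcpt hg.le hle ?_, hasSqrtOn_of_green_lt hcpt hg.le hle ?_⟩
  · exact (hsaddle ε hε.ne' (by rwa [abs_of_pos hε])).2
  · have := (hsaddle (-ε) (neg_ne_zero.2 hε.ne') (by rwa [abs_neg, abs_of_pos hε])).2
    rwa [Complex.ofReal_neg, neg_mul, neg_mul, ← sub_eq_add_neg] at this

/-! ### The two pieces of level one -/

lemma quadratic_of_F_eq {x y : ℂ} (h : F a v x = F a v y) (hne : x ≠ y) :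
    x ^ 2 + x * y + y ^ 2 = 3 * a ^ 2 := by
  have h1 := F_sub_F (a := a) (v := v) x y
  rw [h, sub_self] at h1
  exact sub_eq_zero.1 ((mul_eq_zero.1 h1.symm).resolve_left (sub_ne_zero.2 hne))

lemma F_eq_of_quadratic {x y : ℂ} (h : x ^ 2 + x * y + y ^ 2 = 3 * a ^ 2) :
    F a v x = F a v y := by
  rw [← sub_eq_zero, F_sub_F, h, sub_self, mul_zero]

lemma disjoint_comp_marked_cocritical (ha : green a v a = 0) (hg : 0 < green a v (-a)) {x : ℂ}
    (hA : x ∈ comp a v (green a v (-a)) a) (hB : x ∈ comp a v (green a v (-a)) (-2 * a)) :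
    False := by
  refine cocritical_notMem_comp ha hg ?_
  rw [comp_eq_of_mem hA hB]
  exact mem_comp_self (neg_two_mul_mem_sublevel ha hg)

lemma mem_comp_marked_or_cocritical (ha : green a v a = 0) (hg : 0 < green a v (-a)) {x : ℂ}
    (hx : x ∈ sublevel a v (green a v (-a))) :
    x ∈ comp a v (green a v (-a)) a ∨ x ∈ comp a v (green a v (-a)) (-2 * a) :=
  mem_comp_or_mem_comp ha hg (isPreconnected_sublevel ha (by linarith)) hx

lemma exists_mem_comp_F_eq (ha : green a v a = 0) (hg : 0 < green a v (-a)) {z w : ℂ}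
    (hz : z ∈ sublevel a v (green a v (-a))) (hw : w ∈ sublevel a v (3 * green a v (-a))) :
    ∃ x ∈ comp a v (green a v (-a)) z, F a v x = w := by
  have h := image_comp hz
  rw [comp_eq_sublevel (isPreconnected_sublevel ha (by linarith)) (F_mem_sublevel.2 hz)] at h
  rw [← h] at hw
  exact hw

/-- The values taken twice on `X`, with multiplicity. -/
def doubleValues (a v : ℂ) (X : Set ℂ) : Set ℂ :=
  {w | ∃ x ∈ X, ∃ y ∈ X, x ^ 2 + x * y + y ^ 2 = 3 * a ^ 2 ∧ F a v x = w}

lemma isClosed_doubleValues {X : Set ℂ} (hX : IsCompact X) : IsClosed (doubleValues a v X) := by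
  have hcl : IsClosed {p : ℂ × ℂ | p.1 ^ 2 + p.1 * p.2 + p.2 ^ 2 = 3 * a ^ 2} :=
    isClosed_eq (by fun_prop) continuous_const
  have h := (((hX.prod hX).inter_right hcl).image
    ((continuous_F (a := a) (v := v)).comp continuous_fst)).isClosed
  convert h using 1
  ext w
  constructor
  · rintro ⟨x, hx, y, hy, hxy, rfl⟩
    exact ⟨(x, y), ⟨⟨hx, hy⟩, hxy⟩, rfl⟩
  · rintro ⟨⟨x, y⟩, ⟨⟨hx, hy⟩, hxy⟩, rfl⟩
    exact ⟨x, hx, y, hy, hxy, rfl⟩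

/-- A fibre of a cubic has three points with multiplicity, so it cannot contain two disjoint pairs.
-/
lemma false_of_double_roots {x y x' y' : ℂ} (h : x ^ 2 + x * y + y ^ 2 = 3 * a ^ 2)
    (h' : x' ^ 2 + x' * y' + y' ^ 2 = 3 * a ^ 2) (hF : F a v x = F a v x')
    (hx : x' ≠ x) (hy : x' ≠ y) (hx' : y' ≠ x) (hy' : y' ≠ y) : False := by
  have hFy : F a v y' = F a v x := (F_eq_of_quadratic h').symm.trans hF.symm
  have third : ∀ t, F a v t = F a v x → t ≠ x → t ≠ y → t = -x - y := by
    intro t ht htx hty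
    have h1 := quadratic_of_F_eq ht htx
    have h2 : (t - y) * (t + x + y) = 0 := by linear_combination h1 - h
    have h3 := (mul_eq_zero.1 h2).resolve_left (sub_ne_zero.2 hty)
    linear_combination h3
  have e1 := third x' hF.symm hx hy
  have e2 := third y' hFy hx' hy'
  have e3 : y' = x' := e2.trans e1.symm
  have e4 : x = -x' - y := by rw [e1]; ring
  subst e3
  have h5 : (y - y') * (y + 2 * y') = 0 := by
    rw [e4] at h
    linear_combination h - h'
  rcases mul_eq_zero.1 h5 with h6 | h6
  · exact hy (sub_eq_zero.1 h6).symm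
  · apply hx
    rw [e4]
    linear_combination h6

/-- The cubic map is injective on the component of level one around the cocritical point. -/
lemma injOn_comp_cocritical (ha : green a v a = 0) (hg : 0 < green a v (-a)) :
    Set.InjOn (F a v) (comp a v (green a v (-a)) (-2 * a)) := by
  intro x hx y hy hxy
  by_contra hne
  set g := green a v (-a) with hgdef
  have hdisj : ∀ s ∈ comp a v g a, ∀ t ∈ comp a v g (-2 * a), s ≠ t := by
    rintro s hs t ht rfl
    exact disjoint_comp_marked_cocritical ha hg hs ht
  have hmem : ∀ z : ℂ, ∀ s ∈ closure (comp a v g z), F a v s ∈ sublevel a v (3 * g) →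
      s ∈ comp a v g z := fun z s hs hFs => mem_comp_of_mem_closure hs (F_mem_sublevel.1 hFs)
  have hpre : IsPreconnected (sublevel a v (3 * g)) := isPreconnected_sublevel ha (by linarith)
  -- Each value has a preimage in both components, and the third root makes it double in one of
  -- them. `F a` is double on the marked side and `F x` on the other, so connectedness of `{G < 3g}`
  -- yields a value double on both.
  obtain ⟨w, hw, ⟨x₁, hx₁, y₁, hy₁, h₁, rfl⟩, ⟨x₂, hx₂, y₂, hy₂, h₂, h₂₁⟩⟩ :=
    isPreconnected_closed_iff.1 hpre (doubleValues a v (closure (comp a v g a)))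
      (doubleValues a v (closure (comp a v g (-2 * a))))
      (isClosed_doubleValues isCompact_closure_comp) (isClosed_doubleValues isCompact_closure_comp)
      (by
        intro w hw
        obtain ⟨s, hs, hsw⟩ := exists_mem_comp_F_eq ha hg (marked_mem_sublevel ha hg) hw
        obtain ⟨t, ht, htw⟩ := exists_mem_comp_F_eq ha hg (neg_two_mul_mem_sublevel ha hg) hw
        have hq := quadratic_of_F_eq (hsw.trans htw.symm) (hdisj s hs t ht)
        have hs3 : s ^ 2 + s * (-s - t) + (-s - t) ^ 2 = 3 * a ^ 2 := by linear_combination hq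
        have ht3 : t ^ 2 + t * (-s - t) + (-s - t) ^ 2 = 3 * a ^ 2 := by linear_combination hq
        have h3 : -s - t ∈ sublevel a v g := by
          rw [← F_mem_sublevel, ← F_eq_of_quadratic hs3, hsw]
          exact hw
        rcases mem_comp_marked_or_cocritical ha hg h3 with h | h
        · exact Or.inl ⟨s, subset_closure hs, _, subset_closure h, hs3, hsw⟩
        · exact Or.inr ⟨t, subset_closure ht, _, subset_closure h, ht3, htw⟩)
      ⟨F a v a, F_mem_sublevel.2 (marked_mem_sublevel ha hg), a,
        subset_closure (mem_comp_self (marked_mem_sublevel ha hg)), a,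
        subset_closure (mem_comp_self (marked_mem_sublevel ha hg)), by ring, rfl⟩
      ⟨F a v x, F_mem_sublevel.2 (comp_subset hx), x, subset_closure hx, y, subset_closure hy,
        quadratic_of_F_eq hxy hne, rfl⟩
  have k1 := hmem _ _ hx₁ hw
  have k2 := hmem _ _ hy₁ (by rwa [← F_eq_of_quadratic h₁])
  have k3 := hmem _ _ hx₂ (by rwa [h₂₁])
  have k4 := hmem _ _ hy₂ (by rwa [← F_eq_of_quadratic h₂, h₂₁])
  exact false_of_double_roots h₂ h₁ h₂₁ (hdisj _ k1 _ k3) (hdisj _ k1 _ k4) (hdisj _ k2 _ k3)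
    (hdisj _ k2 _ k4)

/-- The inverse branch of the cubic map with values in the component of level one around the
cocritical point. -/
lemma exists_inverse_branch (ha : green a v a = 0) (hg : 0 < green a v (-a)) :
    ∃ s : ℂ → ℂ, ContinuousOn s (sublevel a v (3 * green a v (-a))) ∧
      ∀ w ∈ sublevel a v (3 * green a v (-a)),
        s w ∈ comp a v (green a v (-a)) (-2 * a) ∧ F a v (s w) = w := by
  have hex : ∀ w : ℂ, ∃ t, w ∈ sublevel a v (3 * green a v (-a)) →
      t ∈ comp a v (green a v (-a)) (-2 * a) ∧ F a v t = w := by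
    intro w
    by_cases hw : w ∈ sublevel a v (3 * green a v (-a))
    · obtain ⟨t, ht, htw⟩ := exists_mem_comp_F_eq ha hg (neg_two_mul_mem_sublevel ha hg) hw
      exact ⟨t, fun _ => ⟨ht, htw⟩⟩
    · exact ⟨0, fun h => absurd h hw⟩
  choose s hs using hex
  refine ⟨s, fun w hw O hO => ?_, hs⟩
  have h1 : F a v '' (O ∩ comp a v (green a v (-a)) (-2 * a)) ∈ 𝓝 w := by
    have := (isOpenMap_F (a := a) (v := v)).image_mem_nhds (inter_mem hO (isOpen_comp.mem_nhds (hs w hw).1))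
    rwa [(hs w hw).2] at this
  rw [mem_map]
  filter_upwards [mem_nhdsWithin_of_mem_nhds h1, self_mem_nhdsWithin] with w' hw' hmem
  obtain ⟨t, ⟨htO, htB⟩, rfl⟩ := hw'
  have : s (F a v t) = t := injOn_comp_cocritical ha hg (hs _ hmem).1 htB (hs _ hmem).2
  rw [Set.mem_preimage, this]
  exact htO

/-! ### Univalence on noncritical pieces -/

/-- `F(2a) = F(-a)` forces `G(2a) = G(-a)`. -/
lemma notMem_comp_free {c : ℝ} (hc : c ≤ green a v (-a)) {z : ℂ} : 2 * a ∉ comp a v c z := by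
  intro h
  have h1 : green a v (2 * a) < c := comp_subset h
  have h2 := green_F (a := a) (v := v) (2 * a)
  rw [F_two_mul, green_F] at h2
  linarith

/-- The cubic map is injective on the components that contain no critical point. -/
theorem injOn_comp (ha : green a v a = 0) (hg : 0 < green a v (-a)) {c : ℝ}
    (hc : c ≤ green a v (-a)) {z : ℂ} (haz : a ∉ comp a v c z) :
    Set.InjOn (F a v) (comp a v c z) := by
  intro x hx y hy hxy
  set g := green a v (-a) with hgdef
  have hxg : x ∈ sublevel a v g := sublevel_mono hc (comp_subset hx)
  rw [comp_eq hx] at hy haz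
  have hsub : comp a v c x ⊆ comp a v g x := comp_mono hc x
  rcases mem_comp_marked_or_cocritical ha hg hxg with hA | hB
  swap
  · rw [← comp_eq hB] at hsub
    exact injOn_comp_cocritical ha hg hB (hsub hy) hxy
  by_contra hne
  rw [← comp_eq hA] at hsub
  obtain ⟨s, hscont, hs⟩ := exists_inverse_branch ha hg
  have hxc : x ∈ sublevel a v c := comp_subset hx
  obtain ⟨Γ, hΓsub, hΓ, hΓconn, hxΓ, hyΓ⟩ := exists_compact_connected (mem_comp_self hxc) hy
  have hΓA : Γ ⊆ comp a v g a := hΓsub.trans hsub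
  have hFΓ : ∀ u ∈ Γ, F a v u ∈ sublevel a v (3 * g) := fun u hu =>
    F_mem_sublevel.2 (comp_subset (hΓA hu))
  -- `T u` is the point of the cocritical component with the same image as `u`.
  set T : ℂ → ℂ := fun u => s (F a v u) with hT
  have hTcont : ContinuousOn T Γ := hscont.comp continuous_F.continuousOn hFΓ
  have hTF : ∀ u ∈ Γ, F a v (T u) = F a v u := fun u hu => (hs _ (hFΓ u hu)).2
  have hTne : ∀ u ∈ Γ, u ≠ T u := fun u hu h =>
    disjoint_comp_marked_cocritical ha hg (hΓA hu) (h ▸ (hs _ (hFΓ u hu)).1)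
  have hTquad : ∀ u ∈ Γ, u ^ 2 + u * T u + T u ^ 2 = 3 * a ^ 2 := fun u hu =>
    quadratic_of_F_eq (hTF u hu).symm (hTne u hu)
  have hTc : ∀ u ∈ Γ, T u ∈ sublevel a v c := fun u hu => by
    rw [← F_mem_sublevel, hTF u hu, F_mem_sublevel]
    exact comp_subset (hΓsub hu)
  have hΓT : T '' Γ ⊆ comp a v c (T x) :=
    subset_comp (hΓconn.image T hTcont) ⟨x, hxΓ, rfl⟩ (by
      rintro _ ⟨u, hu, rfl⟩
      exact hTc u hu)
  -- Otherwise `F a` lies in the common image of both components, so the component of `x` contains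
  -- `a` or `-2a`.
  have hmarked : -2 * a ∉ comp a v c (T x) := by
    intro h
    have h1 : F a v a ∈ F a v '' comp a v c x := by
      rw [image_comp hxc, ← hTF x hxΓ, ← image_comp (hTc x hxΓ), ← F_neg_two_mul]
      exact ⟨_, h, rfl⟩
    obtain ⟨x', hx', hFx'⟩ := h1
    rcases eq_or_eq_of_F_eq_marked hFx' with rfl | rfl
    · exact haz hx'
    · exact cocritical_notMem_comp ha hg (hsub hx')
  have hTΓ : IsCompact (T '' Γ) := hΓ.image_of_continuousOn hTcont
  obtain ⟨r₁, hr₁, hs₁⟩ := hasSqrtOn_of_notMem_comp hTΓ hΓT hmarked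
  obtain ⟨r₂, hr₂, hs₂⟩ := hasSqrtOn_of_notMem_comp hTΓ hΓT (notMem_comp_free hc)
  have hk : halfExp (-3) ^ 2 = -3 := halfExp_sq (by norm_num)
  have hmaps : Set.MapsTo T Γ (T '' Γ) := Set.mapsTo_image T Γ
  have hTmem : ∀ u ∈ Γ, T u ∈ comp a v c (T x) := fun u hu => hΓT ⟨u, hu, rfl⟩
  -- The quadratic relation reads `(2u + T u)² = -3 (T u + 2a)(T u - 2a)`. The right side has a
  -- continuous root depending only on `T u`, and the sign is constant on `Γ`; thus `T x = T y`
  -- forces `x = y`.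
  have hsign := hΓconn.eq_or_eq_neg_of_sq_eq (f := fun u => 2 * u + T u)
    (g := fun u => halfExp (-3) * (r₁ (T u) * r₂ (T u)))
    ((continuousOn_const.mul continuousOn_id).add hTcont)
    (continuousOn_const.mul ((hr₁.comp hTcont hmaps).mul (hr₂.comp hTcont hmaps)))
    (by
      intro u hu
      simp only [Pi.pow_apply]
      rw [mul_pow, mul_pow, hk, hs₁ _ (hmaps hu), hs₂ _ (hmaps hu)]
      linear_combination 4 * hTquad u hu)
    (by
      intro u hu
      refine mul_ne_zero (halfExp_ne_zero _) (mul_ne_zero (fun h0 => ?_) fun h0 => ?_)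
      · have := hs₁ _ (hmaps hu)
        rw [h0] at this
        have hT2 : -2 * a = T u := by linear_combination this
        exact hmarked (hT2 ▸ hTmem u hu)
      · have := hs₂ _ (hmaps hu)
        rw [h0] at this
        have hT2 : 2 * a = T u := by linear_combination this
        exact notMem_comp_free hc (hT2 ▸ hTmem u hu))
  have hTxy : T x = T y := by simp only [hT, hxy]
  have hthird : T x = -x - y := by
    have h1 := hTquad x hxΓ
    have h2 := quadratic_of_F_eq hxy hne
    have h3 : (T x - y) * (T x + x + y) = 0 := by linear_combination h1 - h2
    have h4 := (mul_eq_zero.1 h3).resolve_left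
      (sub_ne_zero.2 (by rw [hTxy]; exact (hTne y hyΓ).symm))
    linear_combination h4
  have hend : 2 * x + T x = 2 * y + T y := by
    rcases hsign with h | h
    · have h1 := h hxΓ
      have h2 := h hyΓ
      simp only at h1 h2
      rw [h1, h2, hTxy]
    · have h1 := h hxΓ
      have h2 := h hyΓ
      simp only [Pi.neg_apply] at h1 h2
      rw [h1, h2, hTxy]
  apply hne
  rw [← hTxy] at hend
  have : (2 : ℂ) ≠ 0 := two_ne_zero
  apply mul_left_cancel₀ this
  linear_combination hend

/-! ### Pulling back common pieces -/

lemma mem_comp_of_F_mem_of_notMem (ha : green a v a = 0) (hg : 0 < green a v (-a)) {c : ℝ}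
    (hc : c ≤ green a v (-a)) {x z : ℂ} (haz : a ∉ comp a v c z) (hx : x ∈ comp a v c z)
    (hz : z ∈ sublevel a v (c / 3)) (hFx : F a v x ∈ comp a v c (F a v z)) :
    x ∈ comp a v (c / 3) z := by
  have h := image_comp hz
  rw [mul_div_cancel₀ c three_ne_zero] at h
  rw [← h] at hFx
  obtain ⟨x', hx', hxx'⟩ := hFx
  have hc0 : 0 ≤ c := by
    have : green a v z < c / 3 := hz
    linarith [green_nonneg (a := a) (v := v) z]
  have := injOn_comp ha hg hc haz (comp_mono (by linarith) z hx') hx hxx'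
  rwa [← this]

/-- The smaller component around `x` maps onto one containing `F a`, so it contains `a` or `-2a`;
the latter would join `-2a` to `a` below level `G(-a)`. -/
lemma mem_comp_marked_of_F_mem (ha : green a v a = 0) (hg : 0 < green a v (-a)) {c : ℝ}
    (hc : c ≤ green a v (-a)) {x : ℂ} (hx : x ∈ comp a v c a)
    (hFx : F a v x ∈ comp a v c (F a v a)) : x ∈ comp a v (c / 3) a := by
  have h3 : 3 * (c / 3) = c := mul_div_cancel₀ c three_ne_zero
  have hxc : x ∈ sublevel a v (c / 3) := by
    rw [← F_mem_sublevel, h3]; exact comp_subset hFx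
  have hc0 : 0 ≤ c := by
    have : green a v x < c := comp_subset hx
    linarith [green_nonneg (a := a) (v := v) x]
  have h := image_comp hxc
  rw [h3, ← comp_eq hFx] at h
  -- A component taken at a point outside the set is empty.
  have hv : F a v a ∈ comp a v c (F a v a) := by
    by_contra hcon
    have : F a v a ∉ sublevel a v c := fun h' => hcon (mem_comp_self h')
    rw [comp, connectedComponentIn_eq_empty this] at hFx
    exact hFx
  rw [← h] at hv
  obtain ⟨x', hx', hFx'⟩ := hv
  rcases eq_or_eq_of_F_eq_marked hFx' with rfl | rfl
  · exact mem_comp_comm hxc hx'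
  · exfalso
    have h1 := comp_mono (by linarith : c / 3 ≤ c) x hx'
    rw [← comp_eq hx] at h1
    exact cocritical_notMem_comp ha hg (comp_mono hc a h1)

/-! ### Puzzle pieces as components of sublevel sets -/

/-- The value of the Green's function bounding the puzzle pieces of level `ℓ`. -/
noncomputable def levelValue (a v : ℂ) (ℓ : ℕ) : ℝ := 3 * green a v (-a) / 3 ^ ℓ

lemma levelValue_succ (ℓ : ℕ) : levelValue a v (ℓ + 1) = levelValue a v ℓ / 3 := by
  rw [levelValue, levelValue, pow_succ, div_div]

lemma levelValue_one : levelValue a v 1 = green a v (-a) := by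
  rw [levelValue, pow_one, mul_div_cancel_left₀ _ three_ne_zero]

lemma levelValue_pos (hg : 0 < green a v (-a)) (ℓ : ℕ) : 0 < levelValue a v ℓ := by
  unfold levelValue; positivity

lemma levelValue_succ_le (hg : 0 < green a v (-a)) (ℓ : ℕ) :
    levelValue a v (ℓ + 1) ≤ green a v (-a) := by
  rw [levelValue, pow_succ, div_le_iff₀ (by positivity)]
  nlinarith [one_le_pow₀ (n := ℓ) (by norm_num : (1 : ℝ) ≤ 3)]

lemma preimage_pieceZero (ℓ : ℕ) :
    (F a v)^[ℓ] ⁻¹' pieceZero a v = sublevel a v (levelValue a v ℓ) := by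
  ext z
  change green a v ((F a v)^[ℓ] z) < green a v (F a v (-a)) ↔ green a v z < levelValue a v ℓ
  rw [green_iterate, green_F, levelValue, lt_div_iff₀ (by positivity), mul_comm]

lemma mem_sublevel_levelValue (hg : 0 < green a v (-a)) {z : ℂ} (hz : green a v z = 0) (ℓ : ℕ) :
    z ∈ sublevel a v (levelValue a v ℓ) := by
  rw [mem_sublevel, hz]; exact levelValue_pos hg ℓ

lemma piece_eq_comp (ha : green a v a = 0) (hg : 0 < green a v (-a)) {z : ℂ}
    (hz : green a v z = 0) (ℓ : ℕ) : piece a v ℓ z = comp a v (levelValue a v ℓ) z := by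
  cases ℓ with
  | zero =>
    have h : pieceZero a v = sublevel a v (levelValue a v 0) := preimage_pieceZero 0
    rw [comp_eq_sublevel _ (mem_sublevel_levelValue hg hz 0), ← h]
    · rfl
    · refine isPreconnected_sublevel ha ?_
      rw [levelValue, pow_zero]; linarith
  | succ ℓ => rw [piece, preimage_pieceZero]; rfl

lemma piece_eq_iff (ha : green a v a = 0) (hg : 0 < green a v (-a)) {x y : ℂ}
    (hx : green a v x = 0) (hy : green a v y = 0) (ℓ : ℕ) :
    piece a v ℓ x = piece a v ℓ y ↔ y ∈ comp a v (levelValue a v ℓ) x := by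
  rw [piece_eq_comp ha hg hx, piece_eq_comp ha hg hy]
  constructor
  · intro h
    rw [h]
    exact mem_comp_self (mem_sublevel_levelValue hg hy ℓ)
  · exact comp_eq

lemma piece_eq_of_succ (ha : green a v a = 0) (hg : 0 < green a v (-a)) {x y : ℂ}
    (hx : green a v x = 0) (hy : green a v y = 0) {ℓ : ℕ}
    (h : piece a v (ℓ + 1) x = piece a v (ℓ + 1) y) : piece a v ℓ x = piece a v ℓ y := by
  rw [piece_eq_iff ha hg hx hy] at h ⊢
  refine comp_mono ?_ x h
  rw [levelValue_succ]
  linarith [levelValue_pos hg ℓ]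

lemma green_F_eq_zero {x : ℂ} (hx : green a v x = 0) : green a v (F a v x) = 0 := by
  rw [green_F, hx, mul_zero]

lemma piece_F_eq (ha : green a v a = 0) (hg : 0 < green a v (-a)) {x y : ℂ}
    (hx : green a v x = 0) (hy : green a v y = 0) {ℓ : ℕ}
    (h : piece a v (ℓ + 1) x = piece a v (ℓ + 1) y) :
    piece a v ℓ (F a v x) = piece a v ℓ (F a v y) := by
  rw [piece_eq_iff ha hg hx hy] at h
  rw [piece_eq_iff ha hg (green_F_eq_zero hx) (green_F_eq_zero hy)]
  have h1 := image_comp (mem_sublevel_levelValue hg hx (ℓ + 1))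
  rw [levelValue_succ, mul_div_cancel₀ _ three_ne_zero, ← levelValue_succ] at h1
  rw [← h1]
  exact ⟨y, h, rfl⟩

/-- The common level is at least one because injectivity needs `levelValue ≤ G(-a)`, which fails at
level zero. -/
lemma piece_eq_of_noncritical (ha : green a v a = 0) (hg : 0 < green a v (-a)) {x y : ℂ}
    (hx : green a v x = 0) (hy : green a v y = 0) {ℓ : ℕ}
    (h : piece a v (ℓ + 1) x = piece a v (ℓ + 1) y)
    (hcrit : piece a v (ℓ + 1) a ≠ piece a v (ℓ + 1) x)
    (hF : piece a v (ℓ + 1) (F a v x) = piece a v (ℓ + 1) (F a v y)) :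
    piece a v (ℓ + 2) x = piece a v (ℓ + 2) y := by
  rw [piece_eq_iff ha hg hx hy] at h ⊢
  rw [ne_comm, Ne, piece_eq_iff ha hg hx ha] at hcrit
  rw [piece_eq_iff ha hg (green_F_eq_zero hx) (green_F_eq_zero hy)] at hF
  rw [levelValue_succ (ℓ + 1)]
  refine mem_comp_of_F_mem_of_notMem ha hg (levelValue_succ_le hg ℓ) hcrit h ?_ hF
  rw [← levelValue_succ]
  exact mem_sublevel_levelValue hg hx _

lemma piece_eq_of_critical (ha : green a v a = 0) (hg : 0 < green a v (-a)) {y : ℂ}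
    (hy : green a v y = 0) {ℓ : ℕ} (h : piece a v (ℓ + 1) a = piece a v (ℓ + 1) y)
    (hF : piece a v (ℓ + 1) (F a v a) = piece a v (ℓ + 1) (F a v y)) :
    piece a v (ℓ + 2) a = piece a v (ℓ + 2) y := by
  rw [piece_eq_iff ha hg ha hy] at h ⊢
  rw [piece_eq_iff ha hg (green_F_eq_zero ha) (green_F_eq_zero hy)] at hF
  rw [levelValue_succ (ℓ + 1)]
  exact mem_comp_marked_of_F_mem ha hg (levelValue_succ_le hg ℓ) h hF

lemma piece_one_eq (ha : green a v a = 0) (hg : 0 < green a v (-a)) {x y : ℂ}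
    (hx : green a v x = 0) (hy : green a v y = 0) (hxa : piece a v 1 a ≠ piece a v 1 x)
    (hya : piece a v 1 a ≠ piece a v 1 y) : piece a v 1 x = piece a v 1 y := by
  rw [Ne, piece_eq_iff ha hg ha hx, levelValue_one] at hxa
  rw [Ne, piece_eq_iff ha hg ha hy, levelValue_one] at hya
  rw [piece_eq_comp ha hg hx, piece_eq_comp ha hg hy, levelValue_one]
  have h1 := mem_sublevel_levelValue hg hx 1
  have h2 := mem_sublevel_levelValue hg hy 1
  rw [levelValue_one] at h1 h2
  rw [← comp_eq ((mem_comp_marked_or_cocritical ha hg h1).resolve_left hxa),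
    ← comp_eq ((mem_comp_marked_or_cocritical ha hg h2).resolve_left hya)]

/-! ### The common level and the puzzle distance -/

lemma le_iSup_iff_of_antitone {P : ℕ → Prop} (h0 : P 0) (hP : ∀ n, P (n + 1) → P n) (ℓ : ℕ) :
    (ℓ : ℕ∞) ≤ ⨆ (n : ℕ) (_ : P n), (n : ℕ∞) ↔ P ℓ := by
  have hdown : ∀ m n, m ≤ n → P n → P m := by
    intro m n hmn
    induction n, hmn using Nat.le_induction with
    | base => exact id
    | succ n _ ih => exact fun h => ih (hP n h)
  constructor
  · intro h
    by_contra hℓ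
    cases ℓ with
    | zero => exact hℓ h0
    | succ ℓ =>
      have hle : (⨆ (n : ℕ) (_ : P n), (n : ℕ∞)) ≤ (ℓ : ℕ∞) := by
        refine iSup₂_le fun n hn => ?_
        rw [Nat.cast_le]
        by_contra! hlt
        exact hℓ (hdown _ _ hlt hn)
      have := h.trans hle
      rw [Nat.cast_le] at this
      omega
  · exact fun h => le_iSup₂_of_le ℓ h le_rfl

lemma le_commonLevel_iff (ha : green a v a = 0) (hg : 0 < green a v (-a)) {x y : ℂ}
    (hx : green a v x = 0) (hy : green a v y = 0) (ℓ : ℕ) :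
    (ℓ : ℕ∞) ≤ commonLevel a v x y ↔ piece a v ℓ x = piece a v ℓ y :=
  le_iSup_iff_of_antitone (P := fun n => piece a v n x = piece a v n y) rfl
    (fun _ h => piece_eq_of_succ ha hg hx hy h) ℓ

lemma puzzleDist_lt_iff (x y : ℂ) (n : ℕ) :
    puzzleDist a v x y < (2 : ℝ) ^ (-(n : ℤ)) ↔ ((n + 1 : ℕ) : ℕ∞) ≤ commonLevel a v x y := by
  unfold puzzleDist
  cases h : commonLevel a v x y with
  | top => simp
  | coe m =>
    rw [if_neg (ENat.natCast_ne_top m), ENat.toNat_natCast, Nat.cast_le,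
      zpow_lt_zpow_iff_right₀ one_lt_two]
    omega

lemma lt_puzzleDist_iff (x y : ℂ) (n : ℕ) :
    (2 : ℝ) ^ (-(n : ℤ)) < puzzleDist a v x y ↔ ¬ (n : ℕ∞) ≤ commonLevel a v x y := by
  unfold puzzleDist
  cases h : commonLevel a v x y with
  | top => simp only [if_true, le_top, not_true_eq_false, iff_false, not_lt]; positivity
  | coe m =>
    rw [if_neg (ENat.natCast_ne_top m), ENat.toNat_natCast, Nat.cast_le,
      zpow_lt_zpow_iff_right₀ one_lt_two]
    omega

lemma puzzleDist_eq_iff (x y : ℂ) (n : ℕ) :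
    puzzleDist a v x y = (2 : ℝ) ^ (-(n : ℤ)) ↔
      (n : ℕ∞) ≤ commonLevel a v x y ∧ ¬ ((n + 1 : ℕ) : ℕ∞) ≤ commonLevel a v x y := by
  have h := lt_puzzleDist_iff (a := a) (v := v) x y n
  rw [← puzzleDist_lt_iff, ← not_not (a := (n : ℕ∞) ≤ _), ← h, not_lt, not_lt]
  exact le_antisymm_iff

/-! ### The marked grid -/

lemma green_critOrbit (ha : green a v a = 0) (k : ℕ) : green a v (critOrbit a v k) = 0 := by
  rw [critOrbit, green_iterate, ha, mul_zero]

lemma critOrbit_succ (k : ℕ) : critOrbit a v (k + 1) = F a v (critOrbit a v k) :=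
  Function.iterate_succ_apply' _ _ _

/-- The points `aᵢ` and `aⱼ` of the marked critical orbit lie in the same piece of level `ℓ`. -/
def SamePiece (a v : ℂ) (ℓ i j : ℕ) : Prop :=
  piece a v ℓ (critOrbit a v i) = piece a v ℓ (critOrbit a v j)

lemma samePiece_zero (i j : ℕ) : SamePiece a v 0 i j := rfl

lemma SamePiece.of_succ (ha : green a v a = 0) (hg : 0 < green a v (-a)) {ℓ i j : ℕ}
    (h : SamePiece a v (ℓ + 1) i j) : SamePiece a v ℓ i j :=
  piece_eq_of_succ ha hg (green_critOrbit ha i) (green_critOrbit ha j) h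

lemma SamePiece.iterate (ha : green a v a = 0) (hg : 0 < green a v (-a)) {ℓ i j : ℕ} (n : ℕ)
    (h : SamePiece a v (ℓ + n) i j) : SamePiece a v ℓ (i + n) (j + n) := by
  induction n generalizing ℓ with
  | zero => exact h
  | succ n ih =>
    have h1 : SamePiece a v (ℓ + 1) (i + n) (j + n) := ih (by rwa [add_right_comm])
    unfold SamePiece
    rw [← add_assoc, ← add_assoc, critOrbit_succ, critOrbit_succ]
    exact piece_F_eq ha hg (green_critOrbit ha _) (green_critOrbit ha _) h1

/-- If `Fᵏ` maps the piece of level `ℓ` around `a₀` with just one critical point along the way,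
then points with image in the piece of level `ℓ - k + 1` around `aₖ` lie in the piece of level
`ℓ + 1` around `a₀`. -/
lemma SamePiece.pullback (ha : green a v a = 0) (hg : 0 < green a v (-a)) {ℓ k m : ℕ}
    (hk : k ≤ ℓ) (h : SamePiece a v ℓ 0 m)
    (hcrit : ∀ i, 0 < i → i < k → ¬ SamePiece a v (ℓ - i) 0 i)
    (hend : SamePiece a v (ℓ - k + 1) k (m + k)) : SamePiece a v (ℓ + 1) 0 m := by
  -- Descent from index `k` to 0: iterating `h` forward gives a common piece of level `ℓ - i` at
  -- index `i`, and the images at index `i + 1` allow one more level. Only `i = 0` is a critical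
  -- passage.
  have hback : ∀ n, n ≤ k → SamePiece a v (ℓ - (k - n) + 1) (k - n) (m + (k - n)) := by
    intro n
    induction n with
    | zero => exact fun _ => hend
    | succ n ih =>
      intro hn
      have h1 := ih (by omega)
      obtain ⟨i, hi⟩ : ∃ i, k - (n + 1) = i := ⟨_, rfl⟩
      obtain ⟨ℓ', hℓ'⟩ : ∃ ℓ', ℓ - i = ℓ' + 1 := ⟨ℓ - i - 1, by omega⟩
      have e1 : k - n = i + 1 := by omega
      have e2 : ℓ - (i + 1) = ℓ' := by omega
      rw [e1, e2] at h1
      rw [hi, hℓ']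
      have h2 : SamePiece a v (ℓ' + 1) i (m + i) := by
        have : SamePiece a v (ℓ' + 1) (0 + i) (m + i) := by
          apply SamePiece.iterate ha hg
          rwa [show ℓ' + 1 + i = ℓ by omega]
        rwa [zero_add] at this
      unfold SamePiece at h1
      rw [← add_assoc, critOrbit_succ, critOrbit_succ] at h1
      rcases Nat.eq_zero_or_pos i with rfl | hi0
      · exact piece_eq_of_critical ha hg (green_critOrbit ha _) h2 h1
      · refine piece_eq_of_noncritical ha hg (green_critOrbit ha _) (green_critOrbit ha _) h2 ?_ h1
        have := hcrit i hi0 (by omega)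
        rwa [hℓ'] at this
  simpa using hback k le_rfl

lemma samePiece_one (ha : green a v a = 0) (hg : 0 < green a v (-a)) {i j : ℕ}
    (hi : ¬ SamePiece a v 1 0 i) (hj : ¬ SamePiece a v 1 0 j) : SamePiece a v 1 i j :=
  piece_one_eq ha hg (green_critOrbit ha i) (green_critOrbit ha j) hi hj

lemma grid_eq_one_iff (ha : green a v a = 0) (hg : 0 < green a v (-a)) (ℓ k : ℕ) :
    grid a v ℓ k = 1 ↔ SamePiece a v ℓ 0 k := by
  unfold grid SamePiece
  rw [← le_commonLevel_iff ha hg (green_critOrbit ha 0) (green_critOrbit ha k)]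
  split_ifs with h <;> simp [h]

lemma grid_eq_zero_or_one (ℓ k : ℕ) : grid a v ℓ k = 0 ∨ grid a v ℓ k = 1 := by
  unfold grid
  split_ifs <;> simp

lemma critDist_lt_iff (ha : green a v a = 0) (hg : 0 < green a v (-a)) (k n : ℕ) :
    critDist a v k < (2 : ℝ) ^ (-(n : ℤ)) ↔ SamePiece a v (n + 1) 0 k := by
  rw [critDist, puzzleDist_lt_iff,
    le_commonLevel_iff ha hg (green_critOrbit ha 0) (green_critOrbit ha k)]
  rfl

lemma lt_critDist_iff (ha : green a v a = 0) (hg : 0 < green a v (-a)) (k n : ℕ) :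
    (2 : ℝ) ^ (-(n : ℤ)) < critDist a v k ↔ ¬ SamePiece a v n 0 k := by
  rw [critDist, lt_puzzleDist_iff,
    le_commonLevel_iff ha hg (green_critOrbit ha 0) (green_critOrbit ha k)]
  rfl

lemma critDist_eq_iff (ha : green a v a = 0) (hg : 0 < green a v (-a)) (k n : ℕ) :
    critDist a v k = (2 : ℝ) ^ (-(n : ℤ)) ↔
      SamePiece a v n 0 k ∧ ¬ SamePiece a v (n + 1) 0 k := by
  rw [critDist, puzzleDist_eq_iff,
    le_commonLevel_iff ha hg (green_critOrbit ha 0) (green_critOrbit ha k),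
    le_commonLevel_iff ha hg (green_critOrbit ha 0) (green_critOrbit ha k)]
  rfl

lemma samePiece_shift_iff (ha : green a v a = 0) (hg : 0 < green a v (-a)) {ℓ k i : ℕ}
    (h : SamePiece a v ℓ 0 k) (hi : i ≤ ℓ) :
    SamePiece a v (ℓ - i) 0 (k + i) ↔ SamePiece a v (ℓ - i) 0 i := by
  have h1 : SamePiece a v (ℓ - i) (0 + i) (k + i) :=
    SamePiece.iterate ha hg i (by rwa [Nat.sub_add_cancel hi])
  rw [zero_add] at h1
  unfold SamePiece at h1 ⊢
  rw [h1]

end CubicPuzzle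

/-! ### The four rules. -/

theorem theorem3p6 (a v : ℂ)
    (hbdd : Bornology.IsBounded (Set.range fun n : ℕ => (CubicPuzzle.F a v)^[n] a))
    (hesc : ¬ Bornology.IsBounded (Set.range fun n : ℕ => (CubicPuzzle.F a v)^[n] (-a))) :
    -- (R1)
    (∀ k : ℕ, CubicPuzzle.grid a v 0 k = 1 ∧
      ∀ ℓ : ℕ, CubicPuzzle.grid a v (ℓ + 1) k ≤ CubicPuzzle.grid a v ℓ k ∧
        0 ≤ CubicPuzzle.grid a v ℓ k) ∧
    -- (R2)
    (∀ ℓ k : ℕ, CubicPuzzle.grid a v ℓ k = 1 →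
      ∀ i : ℕ, i ≤ ℓ →
        CubicPuzzle.grid a v (ℓ - i) (k + i) = CubicPuzzle.grid a v (ℓ - i) i) ∧
    -- (R3)
    (∀ ℓ m k : ℕ, k ≤ ℓ →
      CubicPuzzle.critDist a v m = (2 : ℝ) ^ (-(ℓ : ℤ)) →
      (∀ i : ℕ, 0 < i → i < k → CubicPuzzle.critDist a v i > (2 : ℝ) ^ ((i : ℤ) - (ℓ : ℤ))) →
      CubicPuzzle.critDist a v k < (2 : ℝ) ^ ((k : ℤ) - (ℓ : ℤ)) →
      CubicPuzzle.critDist a v (m + k) = (2 : ℝ) ^ ((k : ℤ) - (ℓ : ℤ))) ∧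
    -- (R4)
    (∀ ℓ k : ℕ,
      CubicPuzzle.critDist a v k = (2 : ℝ) ^ (-(ℓ : ℤ)) →
      (∀ i : ℕ, 0 < i → i < ℓ →
        CubicPuzzle.critDist a v (k + i) > (2 : ℝ) ^ ((i : ℤ) - (ℓ : ℤ))) →
      CubicPuzzle.critDist a v ℓ = 1 →
      CubicPuzzle.critDist a v (ℓ + k) < 1) := by
  have ha : CubicPuzzle.green a v a = 0 := (CubicPuzzle.green_eq_zero_iff a).2 hbdd
  have hg : 0 < CubicPuzzle.green a v (-a) :=
    (CubicPuzzle.green_nonneg _).lt_of_ne'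
      fun h => hesc ((CubicPuzzle.green_eq_zero_iff (-a)).1 h)
  have hexp : ∀ {i ℓ : ℕ}, i ≤ ℓ → (i : ℤ) - (ℓ : ℤ) = -((ℓ - i : ℕ) : ℤ) := by
    intro i ℓ h
    omega
  have hone : (1 : ℝ) = (2 : ℝ) ^ (-((0 : ℕ) : ℤ)) := by simp
  refine ⟨fun k => ⟨?_, fun ℓ => ⟨?_, Nat.zero_le _⟩⟩, fun ℓ k h i hi => ?_,
    fun ℓ m k hk hm hi hk' => ?_, fun ℓ k hk hi hℓ => ?_⟩
  · exact (CubicPuzzle.grid_eq_one_iff ha hg 0 k).2 (CubicPuzzle.samePiece_zero 0 k)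
  · rcases CubicPuzzle.grid_eq_zero_or_one (a := a) (v := v) (ℓ + 1) k with h | h
    · rw [h]; exact Nat.zero_le _
    · rw [h, (CubicPuzzle.grid_eq_one_iff ha hg ℓ k).2
        (((CubicPuzzle.grid_eq_one_iff ha hg (ℓ + 1) k).1 h).of_succ ha hg)]
  · rw [CubicPuzzle.grid_eq_one_iff ha hg] at h
    have hiff := CubicPuzzle.samePiece_shift_iff ha hg h hi
    rw [← CubicPuzzle.grid_eq_one_iff ha hg, ← CubicPuzzle.grid_eq_one_iff ha hg] at hiff
    have h1 := CubicPuzzle.grid_eq_zero_or_one (a := a) (v := v) (ℓ - i) (k + i)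
    have h2 := CubicPuzzle.grid_eq_zero_or_one (a := a) (v := v) (ℓ - i) i
    omega
  · rw [CubicPuzzle.critDist_eq_iff ha hg] at hm
    rw [hexp hk, CubicPuzzle.critDist_lt_iff ha hg] at hk'
    rw [hexp hk, CubicPuzzle.critDist_eq_iff ha hg]
    refine ⟨(CubicPuzzle.samePiece_shift_iff ha hg hm.1 hk).2 (hk'.of_succ ha hg), fun h => ?_⟩
    -- If `a_{m+k}` were as close to `a₀` as `a_k` is, the two would share a piece of level `ℓ - k +
    -- 1`, and pulling back would put `a_m` one level too deep.
    refine hm.2 (CubicPuzzle.SamePiece.pullback ha hg hk hm.1 (fun i hi0 hik => ?_)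
      (Eq.trans (Eq.symm hk') h))
    have := hi i hi0 hik
    rwa [hexp (hik.le.trans hk), gt_iff_lt, CubicPuzzle.lt_critDist_iff ha hg] at this
  · rw [CubicPuzzle.critDist_eq_iff ha hg] at hk
    rw [hone, CubicPuzzle.critDist_eq_iff ha hg] at hℓ
    rw [hone, CubicPuzzle.critDist_lt_iff ha hg]
    by_contra h
    -- Pull back `ℓ` steps from level one: `a_ℓ` and `a_{ℓ+k}`, both outside the critical piece,
    -- share the only other one. Rule (R2) transfers the hypotheses on `a_{k+i}` to `a_i`.
    refine hk.2 (CubicPuzzle.SamePiece.pullback ha hg le_rfl hk.1 (fun i hi0 hil => ?_) ?_)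
    · have := hi i hi0 hil
      rw [hexp hil.le, gt_iff_lt, CubicPuzzle.lt_critDist_iff ha hg] at this
      rwa [← CubicPuzzle.samePiece_shift_iff ha hg hk.1 hil.le]
    · rw [Nat.sub_self, add_comm k ℓ]
      exact CubicPuzzle.samePiece_one ha hg hℓ.2 h
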